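/- Let $\Bbbk$ be an algebraically closed field of characteristic $0$, let $n>1$, let $\lambda\in\Bbbk$ be a primitive $n$th root of unity, and let $H=H_n(\lambda)$ be the Taft algebra: the $\Bbbk$-algebra generated by $g,x$ with relations $g^n=1$, $x^n=0$, $xg=\lambda gx$, which is a Hopf algebra via $\Delta(g)=g\otimes g$, $\Delta(x)=g\otimes x+x\otimes 1$, $\varepsilon(g)=1$, $\varepsilon(x)=0$, $S(g)=g^{n-1}$, $S(x)=-g^{n-1}x$. Let $\mu\in\Bbbk^\times$ have finite multiplicative order $m>1$, and let $A$ be either the quantum plane $\Bbbk_\mu[u,v]=\Bbbk\langle u,v\mid uv-\mu vu\rangle$ or the quantum Weyl algebra $A_1^\mu=\Bbbk\langle u,v\mid uv-\mu vu-1\rangle$. Suppose that $A$ is a left $H$-module algebra (that is, $A$ is a left $H$-module with $h\cdot 1=\varepsilon(h)1$ and $h\cdot(ab)=\sum(h_1\cdot a)(h_2\cdot b)$), that the action is linear, meaning $g\cdot u,\ g\cdot v,\ x\cdot u,\ x\cdot v\in\Bbbk u+\Bbbk v$, and that it is inner faithful, meaning that no nonzero Hopf ideal of $H$ annihilates $A$.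 Let $A^H=\{a\in A: h\cdot a=\varepsilon(h)a\text{ for all }h\in H\}$, and let $A\#H$ be the smash product, that is, $A\otimes H$ with multiplication $(a\#h)(b\#h')=\sum a(h_1\cdot b)\#h_2h'$. Then: 1. Either $x\cdot u=0$ and $A^H=\Bbbk[u^m,v^n]$, or $x\cdot v=0$ and $A^H=\Bbbk[u^n,v^m]$. Here $\Bbbk[a,b]$ denotes the subalgebra of $A$ generated by $a$ and $b$, and the assertion includes that it is a commutative polynomial ring in the two variables $a,b$. 2. $A\#H$ is a prime ring if and only if $m=n$. -/

import Mathlib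

open scoped TensorProduct

namespace TaftSmash

noncomputable section

/-! ### Hopf algebra actions, fixed rings, inner faithfulness -/

section HopfActions

open Coalgebra

variable (k H A : Type*) [Field k] [Ring H] [HopfAlgebra k H] [Ring A] [Algebra k A]

/-- A (left) action of the Hopf algebra `H` on the `k`-algebra `A`, i.e. a left `H`-module
algebra structure on `A`: a `k`-linear representation of the algebra `H` on the vector space `A`
with `h · 1 = ε(h) 1` and `h · (a b) = ∑ (h₁ · a) (h₂ · b)`. -/
structure HopfAction where
  /-- the representation, `act h a = h · a` -/
  act : H →ₐ[k] Module.End k A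
  act_one : ∀ h : H, act h 1 = counit (R := k) h • (1 : A)
  act_mul : ∀ (h : H) (a b : A), act h (a * b) =
    LinearMap.mul' k A
      (TensorProduct.map (act.toLinearMap.flip a) (act.toLinearMap.flip b) (comul (R := k) h))

variable {k H A}

namespace HopfAction

variable (α : HopfAction k H A)

theorem act_mul_sum (h : H) (a b : A) {ι : Type*} (r : Coalgebra.Repr k h ι) :
    α.act h (a * b) = ∑ i ∈ r.index, α.act (r.left i) a * α.act (r.right i) b := by
  rw [α.act_mul, ← r.eq]
  simp [map_sum]

/-- The action is inner faithful if no nonzero Hopf ideal of `H` annihilates `A`. -/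
def InnerFaithful : Prop :=
  ∀ I : Ideal H, I.IsTwoSided → I.IsHopfIdeal k →
    (∀ h ∈ I, ∀ a : A, α.act h a = 0) → I = ⊥

/-- The fixed ring `A^H = {a | h · a = ε(h) a for all h ∈ H}`. -/
def fixedRing : Subalgebra k A where
  carrier := {a | ∀ h : H, α.act h a = counit (R := k) h • a}
  mul_mem' := by
    intro a b ha hb h
    simp only [Set.mem_ofPred_eq] at ha hb
    rw [α.act_mul_sum h a b (Coalgebra.Repr.arbitrary k h)]
    simp only [ha, hb, smul_mul_smul_comm]
    rw [← Finset.sum_smul]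
    congr 1
    have h1 := Coalgebra.sum_counit_smul (R := k) (Coalgebra.Repr.arbitrary k h)
    have h2 := congrArg (counit (R := k)) h1
    simpa [map_sum] using h2
  add_mem' := by
    intro a b ha hb h
    simp only [Set.mem_ofPred_eq] at ha hb
    rw [map_add, ha, hb, smul_add]
  algebraMap_mem' := by
    intro c h
    rw [Algebra.algebraMap_eq_smul_one, map_smul, α.act_one, smul_comm]

/-! ### The smash product `A # H` -/

/-- The representation of `H` on `A ⊗ H` given by `h · (b ⊗ h') = ∑ (h₁ · b) ⊗ h₂ h'`. -/
def diag : H →ₐ[k] Module.End k (A ⊗[k] H) :=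
  (Module.endTensorEndAlgHom (R := k) (S := k) (A := k) (M := A) (N := H)).comp
    ((Algebra.TensorProduct.map α.act (Algebra.lmul k H)).comp (Bialgebra.comulAlgHom k H))

theorem diag_tmul (h h' : H) (b : A) {ι : Type*} (r : Coalgebra.Repr k h ι) :
    α.diag h (b ⊗ₜ h') = ∑ i ∈ r.index, α.act (r.left i) b ⊗ₜ[k] (r.right i * h') := by
  have : Bialgebra.comulAlgHom k H h = ∑ i ∈ r.index, r.left i ⊗ₜ[k] r.right i := r.eq.symm
  simp only [diag, AlgHom.comp_apply, this, map_sum, LinearMap.sum_apply]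
  rfl

/-- Left multiplication by `a` on the first factor of `A ⊗ H`. -/
def lmulLeft : A →ₐ[k] Module.End k (A ⊗[k] H) :=
  (Module.endTensorEndAlgHom (R := k) (S := k) (A := k) (M := A) (N := H)).comp
    ((Algebra.TensorProduct.includeLeft).comp (Algebra.lmul k A))

@[simp] theorem lmulLeft_tmul (a b : A) (h : H) :
    lmulLeft (k := k) a (b ⊗ₜ[k] h) = (a * b) ⊗ₜ h := rfl

/-- The multiplication of the smash product as a bilinear map:
`(a ⊗ h) (b ⊗ h') = ∑ a (h₁ · b) ⊗ h₂ h'`. -/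
def smashMul : A ⊗[k] H →ₗ[k] Module.End k (A ⊗[k] H) :=
  LinearMap.mul' k _ ∘ₗ
    TensorProduct.map (lmulLeft (k := k) (H := H)).toLinearMap α.diag.toLinearMap

theorem smashMul_tmul' (a : A) (h : H) :
    α.smashMul (a ⊗ₜ h) = lmulLeft a * α.diag h := rfl

theorem smashMul_tmul (a b : A) (h h' : H) {ι : Type*} (r : Coalgebra.Repr k h ι) :
    α.smashMul (a ⊗ₜ h) (b ⊗ₜ h') =
      ∑ i ∈ r.index, (a * α.act (r.left i) b) ⊗ₜ[k] (r.right i * h') := by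
  rw [smashMul_tmul', Module.End.mul_apply, α.diag_tmul h h' b r, map_sum]
  rfl

theorem diag_mul_lmulLeft (h : H) (b : A) {ι : Type*} (r : Coalgebra.Repr k h ι) :
    α.diag h * lmulLeft b =
      ∑ i ∈ r.index, lmulLeft (α.act (r.left i) b) * α.diag (r.right i) := by
  apply TensorProduct.ext'
  intro c h'
  let G : H ⊗[k] (H ⊗[k] H) →ₗ[k] A ⊗[k] H :=
    TensorProduct.map (LinearMap.mul' k A) LinearMap.id ∘ₗ
      (TensorProduct.assoc k A A H).symm.toLinearMap ∘ₗ
      TensorProduct.map (α.act.toLinearMap.flip b)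
        (TensorProduct.map (α.act.toLinearMap.flip c) (LinearMap.mulRight k h'))
  have key := congrArg G (Coalgebra.sum_tmul_tmul_eq r
    (fun i => Coalgebra.Repr.arbitrary k (r.left i))
    (fun i => Coalgebra.Repr.arbitrary k (r.right i)))
  simp only [map_sum] at key
  have hG : ∀ p q s : H, G (p ⊗ₜ (q ⊗ₜ s)) = (α.act p b * α.act q c) ⊗ₜ[k] (s * h') :=
    fun p q s => rfl
  simp only [hG] at key
  simp only [LinearMap.sum_apply, Module.End.mul_apply, lmulLeft_tmul]
  rw [α.diag_tmul h h' (b * c) r]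
  simp only [α.diag_tmul _ h' c (Coalgebra.Repr.arbitrary k (r.right _)), map_sum, lmulLeft_tmul]
  rw [← key]
  refine Finset.sum_congr rfl fun i _ => ?_
  rw [α.act_mul_sum _ b c (Coalgebra.Repr.arbitrary k (r.left i)), TensorProduct.sum_tmul]

theorem smashMul_smashMul (s t : A ⊗[k] H) :
    α.smashMul (α.smashMul s t) = α.smashMul s * α.smashMul t := by
  induction s using TensorProduct.induction_on with
  | zero => simp
  | add s₁ s₂ h₁ h₂ => rw [map_add, LinearMap.add_apply, map_add, h₁, h₂, add_mul]
  | tmul a h =>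
    induction t using TensorProduct.induction_on with
    | zero => simp
    | add t₁ t₂ h₁ h₂ => rw [map_add, map_add, map_add, h₁, h₂, mul_add]
    | tmul b h' =>
      rw [α.smashMul_tmul a b h h' (Coalgebra.Repr.arbitrary k h), map_sum]
      simp only [smashMul_tmul', map_mul]
      have := α.diag_mul_lmulLeft h b (Coalgebra.Repr.arbitrary k h)
      calc _ = lmulLeft a * (∑ i ∈ (Coalgebra.Repr.arbitrary k h).index,
              lmulLeft (α.act ((Coalgebra.Repr.arbitrary k h).left i) b) *
                α.diag ((Coalgebra.Repr.arbitrary k h).right i)) * α.diag h' := by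
            rw [Finset.mul_sum, Finset.sum_mul]
            simp only [mul_assoc]
        _ = _ := by rw [← this]; simp only [mul_assoc]

theorem one_smashMul (t : A ⊗[k] H) : α.smashMul (1 ⊗ₜ 1) t = t := by
  rw [smashMul_tmul', map_one, map_one]; rfl

theorem smashMul_one (t : A ⊗[k] H) : α.smashMul t (1 ⊗ₜ 1) = t := by
  induction t using TensorProduct.induction_on with
  | zero => simp
  | add s₁ s₂ h₁ h₂ => rw [map_add, LinearMap.add_apply, h₁, h₂]
  | tmul a h =>
    rw [α.smashMul_tmul a 1 h 1 (Coalgebra.Repr.arbitrary k h)]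
    simp only [α.act_one, mul_one, mul_smul_comm, TensorProduct.smul_tmul]
    rw [← TensorProduct.tmul_sum, Coalgebra.sum_counit_smul]

/-- The smash product algebra `A # H`: the vector space `A ⊗ H`, the element `a # h` being
`a ⊗ₜ h`, with the multiplication `(a # h) (b # h') = ∑ a (h₁ · b) # h₂ h'`. -/
def SmashProduct (_α : HopfAction k H A) := A ⊗[k] H

instance : AddCommGroup α.SmashProduct := inferInstanceAs (AddCommGroup (A ⊗[k] H))

instance : Module k α.SmashProduct := inferInstanceAs (Module k (A ⊗[k] H))

instance : Ring α.SmashProduct :=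
  { (inferInstance : AddCommGroup α.SmashProduct) with
    mul := fun s t => α.smashMul s t
    one := (1 : A) ⊗ₜ[k] (1 : H)
    mul_assoc := fun s t w => congrArg (fun f => f w) (α.smashMul_smashMul s t)
    one_mul := α.one_smashMul
    mul_one := α.smashMul_one
    left_distrib := fun s t w => map_add (α.smashMul s) t w
    right_distrib := fun s t w => congrArg (fun f => f w) (map_add α.smashMul s t)
    zero_mul := fun s => congrArg (fun f => f s) (map_zero α.smashMul)
    mul_zero := fun s => map_zero (α.smashMul s) }

instance : Algebra k α.SmashProduct :=
  Algebra.ofModule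
    (fun c s t => congrArg (fun f => f t) (map_smul α.smashMul c s))
    (fun c s t => map_smul (α.smashMul s) c t)

/-- The element `a # h` of `A # H`. -/
def SmashProduct.mk (a : A) (h : H) : α.SmashProduct := a ⊗ₜ[k] h

theorem SmashProduct.one_def : (1 : α.SmashProduct) = SmashProduct.mk α 1 1 := rfl

/-- The defining multiplication rule of the smash product. -/
theorem SmashProduct.mk_mul_mk (a b : A) (h h' : H) {ι : Type*} (r : Coalgebra.Repr k h ι) :
    SmashProduct.mk α a h * SmashProduct.mk α b h' =
      ∑ i ∈ r.index, SmashProduct.mk α (a * α.act (r.left i) b) (r.right i * h') :=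
  α.smashMul_tmul a b h h' r

end HopfAction

end HopfActions

/-- A (not necessarily commutative) ring `R` is prime if it is nonzero and
`a R b = 0` only when `a = 0` or `b = 0`. -/
def IsPrimeRing (R : Type*) [Ring R] : Prop :=
  Nontrivial R ∧ ∀ a b : R, (∀ r : R, a * r * b = 0) → a = 0 ∨ b = 0

/-- `S = k[a, b]`: the subalgebra `S` of `A` is generated by `a` and `b`, and it is a (commutative)
polynomial ring in the two variables `a` and `b`. -/
def IsPolynomialRingIn {k A : Type*} [Field k] [Ring A] [Algebra k A]
    (S : Subalgebra k A) (a b : A) : Prop :=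
  S = Algebra.adjoin k {a, b} ∧
    ∃ e : MvPolynomial (Fin 2) k ≃ₐ[k] S,
      (e (MvPolynomial.X 0) : A) = a ∧ (e (MvPolynomial.X 1) : A) = b

/-! ### The quantum planes and the quantum Weyl algebras -/

/-- The names of the generators `u`, `v`. -/
inductive UV
  | u
  | v

/-- The defining relation `u v - μ v u - κ = 0`. -/
inductive QuantumRel {k : Type*} [Field k] (mu κ : k) :
    FreeAlgebra k UV → FreeAlgebra k UV → Prop
  | rel : QuantumRel mu κ
      (FreeAlgebra.ι k UV.u * FreeAlgebra.ι k UV.v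
        - mu • (FreeAlgebra.ι k UV.v * FreeAlgebra.ι k UV.u) - algebraMap k _ κ) 0

/-- The algebra `k⟨u, v | u v - μ v u - κ⟩`. For `κ = 0` this is the quantum plane `k_μ[u, v]`,
for `κ = 1` it is the quantum Weyl algebra `A₁^μ`. -/
def QuantumAlgebra {k : Type*} [Field k] (mu κ : k) := RingQuot (QuantumRel mu κ)

namespace QuantumAlgebra

variable {k : Type*} [Field k] (mu κ : k)

instance : Ring (QuantumAlgebra mu κ) := inferInstanceAs (Ring (RingQuot (QuantumRel mu κ)))

instance : Algebra k (QuantumAlgebra mu κ) :=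
  inferInstanceAs (Algebra k (RingQuot (QuantumRel mu κ)))

/-- The generator `u`. -/
def u : QuantumAlgebra mu κ := RingQuot.mkAlgHom k (QuantumRel mu κ) (FreeAlgebra.ι k UV.u)

/-- The generator `v`. -/
def v : QuantumAlgebra mu κ := RingQuot.mkAlgHom k (QuantumRel mu κ) (FreeAlgebra.ι k UV.v)

end QuantumAlgebra

/-! ### Taft algebras -/

section QBinomial

variable {k : Type*} [Field k]

/-- Gaussian binomial coefficients evaluated at `q`, through their Pascal recursion. -/
def qbinom (q : k) : ℕ → ℕ → k
  | _, 0 => 1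
  | 0, _ + 1 => 0
  | n + 1, i + 1 => qbinom q n i + q ^ (i + 1) * qbinom q n (i + 1)

theorem qbinom_zero_right (q : k) (n : ℕ) : qbinom q n 0 = 1 := by cases n <;> rfl

theorem qbinom_of_lt (q : k) : ∀ {n i : ℕ}, n < i → qbinom q n i = 0
  | 0, 0, h => by omega
  | 0, _ + 1, _ => rfl
  | n + 1, 0, h => by omega
  | n + 1, i + 1, h => by
    rw [qbinom, qbinom_of_lt q (by omega), qbinom_of_lt q (by omega)]; simp

theorem qbinom_self (q : k) : ∀ n : ℕ, qbinom q n n = 1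
  | 0 => rfl
  | n + 1 => by rw [qbinom, qbinom_self q n, qbinom_of_lt q (by omega)]; simp

theorem one_sub_mul_qbinom (q : k) : ∀ n i : ℕ,
    (1 - q ^ (i + 1)) * qbinom q (n + 1) (i + 1) = (1 - q ^ (n + 1)) * qbinom q n i
  | 0, 0 => by simp [qbinom]
  | 0, i + 1 => by simp [qbinom]
  | n + 1, 0 => by
    have h := one_sub_mul_qbinom q n 0
    rw [qbinom_zero_right] at h ⊢
    rw [qbinom, qbinom_zero_right]
    linear_combination q * h
  | n + 1, i + 1 => by
    have h1 := one_sub_mul_qbinom q n i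
    have h2 := one_sub_mul_qbinom q n (i + 1)
    have h3 : qbinom q (n + 1) (i + 1) = qbinom q n i + q ^ (i + 1) * qbinom q n (i + 1) := rfl
    have h4 : qbinom q (n + 2) (i + 2) =
      qbinom q (n + 1) (i + 1) + q ^ (i + 2) * qbinom q (n + 1) (i + 2) := rfl
    rw [h4]
    linear_combination q ^ (i + 2) * h2 + q * h1 + (q ^ (n + 2) - q) * h3

/-- The middle Gaussian binomial coefficients vanish at primitive roots of unity. -/
theorem qbinom_eq_zero {q : k} {n i : ℕ} (hq : IsPrimitiveRoot q n) (h0 : 0 < i) (hi : i < n) :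
    qbinom q n i = 0 := by
  obtain ⟨i, rfl⟩ : ∃ j, i = j + 1 := ⟨i - 1, by omega⟩
  obtain ⟨n, rfl⟩ : ∃ j, n = j + 1 := ⟨n - 1, by omega⟩
  have h := one_sub_mul_qbinom q n i
  rw [hq.pow_eq_one, sub_self, zero_mul] at h
  rcases mul_eq_zero.1 h with h | h
  · exact absurd (sub_eq_zero.1 h).symm (hq.pow_ne_one_of_pos_of_lt h0.ne' hi)
  · exact h

variable {B : Type*} [Ring B] [Algebra k B]

theorem mul_pow_of_qcomm {q : k} {a b : B} (hab : b * a = q • (a * b)) (j : ℕ) :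
    b * a ^ j = q ^ j • (a ^ j * b) := by
  induction j with
  | zero => simp
  | succ j ih =>
    rw [pow_succ, ← mul_assoc, ih, smul_mul_assoc, mul_assoc, hab, mul_smul_comm, smul_smul,
      ← mul_assoc, pow_succ]

theorem pow_mul_of_qcomm {q : k} {a b : B} (hab : b * a = q • (a * b)) (j : ℕ) :
    b ^ j * a = q ^ j • (a * b ^ j) := by
  induction j with
  | zero => simp
  | succ j ih =>
    rw [pow_succ, mul_assoc, hab, mul_smul_comm, ← mul_assoc, ih, smul_mul_assoc, smul_smul,
      mul_assoc, pow_succ']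

theorem add_pow_of_qcomm {q : k} {a b : B} (hab : b * a = q • (a * b)) (n : ℕ) :
    (a + b) ^ n = ∑ i ∈ Finset.range (n + 1), qbinom q n i • (a ^ i * b ^ (n - i)) := by
  induction n with
  | zero => simp [qbinom]
  | succ n ih =>
    rw [pow_succ', ih, add_mul, Finset.mul_sum, Finset.mul_sum]
    have e1 : ∀ i ∈ Finset.range (n + 1), b * (qbinom q n i • (a ^ i * b ^ (n - i))) =
        (q ^ i * qbinom q n i) • (a ^ i * b ^ (n + 1 - i)) := by
      intro i hi
      have : n + 1 - i = (n - i) + 1 := by have := Finset.mem_range.1 hi; omega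
      rw [mul_smul_comm, ← mul_assoc, mul_pow_of_qcomm hab, smul_mul_assoc, smul_smul, mul_assoc,
        this, pow_succ', mul_comm (q ^ i)]
    have e2 : ∀ i ∈ Finset.range (n + 1), a * (qbinom q n i • (a ^ i * b ^ (n - i))) =
        qbinom q n i • (a ^ (i + 1) * b ^ (n + 1 - (i + 1))) := by
      intro i _
      rw [mul_smul_comm, ← mul_assoc, ← pow_succ', Nat.add_sub_add_right]
    rw [Finset.sum_congr rfl e1, Finset.sum_congr rfl e2]
    rw [Finset.sum_range_succ' _ (n + 1)]
    have e3 : ∑ i ∈ Finset.range (n + 1), (q ^ i * qbinom q n i) • (a ^ i * b ^ (n + 1 - i)) =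
        ∑ i ∈ Finset.range (n + 2), (q ^ i * qbinom q n i) • (a ^ i * b ^ (n + 1 - i)) := by
      rw [Finset.sum_range_succ _ (n + 1), qbinom_of_lt q (Nat.lt_succ_self n)]
      simp
    rw [e3, Finset.sum_range_succ' _ (n + 1)]
    simp only [qbinom, add_smul, Finset.sum_add_distrib, qbinom_zero_right, pow_zero, one_smul,
      one_mul]
    abel

theorem add_pow_eq_zero_of_qcomm {q : k} {n : ℕ} (hn : 1 < n) (hq : IsPrimitiveRoot q n)
    {a b : B} (hab : b * a = q • (a * b)) (ha : a ^ n = 0) (hb : b ^ n = 0) :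
    (a + b) ^ n = 0 := by
  rw [add_pow_of_qcomm hab]
  refine Finset.sum_eq_zero fun i hi => ?_
  rcases Nat.eq_zero_or_pos i with rfl | h0
  · simp [hb]
  · rcases Nat.lt_or_ge i n with h | h
    · rw [qbinom_eq_zero hq h0 h, zero_smul]
    · have : i = n := by have := Finset.mem_range.1 hi; omega
      subst this
      rw [ha, zero_mul, smul_zero]

theorem mul_pow_eq_zero_of_qcomm {q : k} {n : ℕ}
    {a b : B} (hab : b * a = q • (a * b)) (hb : b ^ n = 0) : (a * b) ^ n = 0 := by
  have : ∀ j : ℕ, ∃ c : k, (a * b) ^ j = c • (a ^ j * b ^ j) := by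
    intro j
    induction j with
    | zero => exact ⟨1, by simp⟩
    | succ j ih =>
      obtain ⟨c, hc⟩ := ih
      refine ⟨c * q ^ j, ?_⟩
      calc (a * b) ^ (j + 1) = c • (a ^ j * (b ^ j * a) * b) := by
            rw [pow_succ, hc, smul_mul_assoc]; simp only [mul_assoc]
        _ = _ := by
            rw [pow_mul_of_qcomm hab, mul_smul_comm, smul_mul_assoc, smul_smul, pow_succ, pow_succ]
            simp only [mul_assoc]
  obtain ⟨c, hc⟩ := this n
  rw [hc, hb, mul_zero, smul_zero]

end QBinomial

/-- The names of the generators `g`, `x`. -/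
inductive GX
  | g
  | x

/-- The defining relations `g ^ n = 1`, `x ^ n = 0`, `x g = λ g x`. -/
inductive TaftRel {k : Type*} [Field k] (n : ℕ) (lam : k) :
    FreeAlgebra k GX → FreeAlgebra k GX → Prop
  | g_pow : TaftRel n lam (FreeAlgebra.ι k GX.g ^ n) 1
  | x_pow : TaftRel n lam (FreeAlgebra.ι k GX.x ^ n) 0
  | x_mul_g : TaftRel n lam (FreeAlgebra.ι k GX.x * FreeAlgebra.ι k GX.g)
      (lam • (FreeAlgebra.ι k GX.g * FreeAlgebra.ι k GX.x))

/-- The `n`-th Taft algebra `H_n(λ) = k⟨g, x | g ^ n = 1, x ^ n = 0, x g = λ g x⟩`, for `n > 1`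
and `λ` a primitive `n`-th root of unity. -/
def Taft {k : Type*} [Field k] {n : ℕ} {lam : k} (_hn : 1 < n) (_hlam : IsPrimitiveRoot lam n) :=
  RingQuot (TaftRel n lam)

namespace Taft

variable {k : Type*} [Field k] {n : ℕ} {lam : k} (hn : 1 < n) (hlam : IsPrimitiveRoot lam n)

instance : Ring (Taft hn hlam) := inferInstanceAs (Ring (RingQuot (TaftRel n lam)))

instance : Algebra k (Taft hn hlam) := inferInstanceAs (Algebra k (RingQuot (TaftRel n lam)))

/-- The generator `g`. -/
def g : Taft hn hlam := RingQuot.mkAlgHom k (TaftRel n lam) (FreeAlgebra.ι k GX.g)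

/-- The generator `x`. -/
def x : Taft hn hlam := RingQuot.mkAlgHom k (TaftRel n lam) (FreeAlgebra.ι k GX.x)

theorem g_pow : g hn hlam ^ n = 1 := by
  have := RingQuot.mkAlgHom_rel k (TaftRel.g_pow (n := n) (lam := lam))
  rw [map_pow, map_one] at this
  exact this

theorem x_pow : x hn hlam ^ n = 0 := by
  have := RingQuot.mkAlgHom_rel k (TaftRel.x_pow (n := n) (lam := lam))
  rw [map_pow, map_zero] at this
  exact this

theorem x_mul_g : x hn hlam * g hn hlam = lam • (g hn hlam * x hn hlam) := by
  have := RingQuot.mkAlgHom_rel k (TaftRel.x_mul_g (n := n) (lam := lam))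
  rw [map_smul, map_mul, map_mul] at this
  exact this

theorem g_pow_pred_mul : g hn hlam ^ (n - 1) * g hn hlam = 1 := by
  rw [← pow_succ, Nat.sub_add_cancel hn.le, g_pow]

theorem g_mul_pow_pred : g hn hlam * g hn hlam ^ (n - 1) = 1 := by
  rw [← pow_succ', Nat.sub_add_cancel hn.le, g_pow]

section lift

variable {B : Type*} [Ring B] [Algebra k B]

/-- The universal property of `H_n(λ)`. -/
def lift (G X : B) (h1 : G ^ n = 1) (h2 : X ^ n = 0) (h3 : X * G = lam • (G * X)) :
    Taft hn hlam →ₐ[k] B :=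
  RingQuot.liftAlgHom k ⟨FreeAlgebra.lift k (fun i => match i with | GX.g => G | GX.x => X), by
    intro a b hab
    cases hab <;> simp [h1, h2, h3]⟩

@[simp] theorem lift_g (G X : B) (h1 : G ^ n = 1) (h2 : X ^ n = 0)
    (h3 : X * G = lam • (G * X)) : lift hn hlam G X h1 h2 h3 (g hn hlam) = G := by
  refine (RingQuot.liftAlgHom_mkAlgHom_apply k _ _ _).trans ?_
  simp

@[simp] theorem lift_x (G X : B) (h1 : G ^ n = 1) (h2 : X ^ n = 0)
    (h3 : X * G = lam • (G * X)) : lift hn hlam G X h1 h2 h3 (x hn hlam) = X := by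
  refine (RingQuot.liftAlgHom_mkAlgHom_apply k _ _ _).trans ?_
  simp

variable {hn hlam} in
theorem algHom_ext {B : Type*} [Semiring B] [Algebra k B] {f f' : Taft hn hlam →ₐ[k] B}
    (h1 : f (g hn hlam) = f' (g hn hlam))
    (h2 : f (x hn hlam) = f' (x hn hlam)) : f = f' := by
  refine RingQuot.ringQuot_ext' k (s := TaftRel n lam) f f' ?_
  refine FreeAlgebra.hom_ext ?_
  funext i
  cases i
  · exact h1
  · exact h2

end lift

theorem induction {P : Taft hn hlam → Prop} (hc : ∀ c : k, P (algebraMap k _ c))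
    (hg : P (g hn hlam)) (hx : P (x hn hlam)) (hadd : ∀ a b, P a → P b → P (a + b))
    (hmul : ∀ a b, P a → P b → P (a * b)) (a : Taft hn hlam) : P a := by
  obtain ⟨a, rfl⟩ := RingQuot.mkAlgHom_surjective k (TaftRel n lam) a
  induction a using FreeAlgebra.induction with
  | grade0 r =>
    exact ((RingQuot.mkAlgHom k (TaftRel n lam)).commutes r).symm ▸ hc r
  | grade1 i => cases i; exacts [hg, hx]
  | mul a b ha hb => rw [map_mul]; exact hmul _ _ ha hb
  | add a b ha hb => rw [map_add]; exact hadd _ _ ha hb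

/-- The comultiplication: `Δ(g) = g ⊗ g`, `Δ(x) = g ⊗ x + x ⊗ 1`. -/
def comulHom : Taft hn hlam →ₐ[k] Taft hn hlam ⊗[k] Taft hn hlam :=
  lift hn hlam (g hn hlam ⊗ₜ g hn hlam) (g hn hlam ⊗ₜ x hn hlam + x hn hlam ⊗ₜ 1)
    (by rw [Algebra.TensorProduct.tmul_pow, g_pow, Algebra.TensorProduct.one_def])
    (by
      refine add_pow_eq_zero_of_qcomm hn hlam ?_ ?_ ?_
      · simp only [Algebra.TensorProduct.tmul_mul_tmul, one_mul, mul_one, x_mul_g,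
          TensorProduct.smul_tmul']
      · rw [Algebra.TensorProduct.tmul_pow, x_pow, TensorProduct.tmul_zero]
      · rw [Algebra.TensorProduct.tmul_pow, x_pow, TensorProduct.zero_tmul])
    (by
      simp only [add_mul, mul_add, Algebra.TensorProduct.tmul_mul_tmul, x_mul_g, one_mul, mul_one,
        TensorProduct.smul_tmul', TensorProduct.tmul_smul, smul_add])

/-- The counit: `ε(g) = 1`, `ε(x) = 0`. -/
def counitHom : Taft hn hlam →ₐ[k] k :=
  lift hn hlam 1 0 (one_pow n) (zero_pow (by omega)) (by simp)

/-- The antipode, `S(g) = g ^ (n - 1)`, `S(x) = - g ^ (n - 1) x`, as an algebra homomorphism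
to the opposite algebra. -/
def antipodeHom : Taft hn hlam →ₐ[k] (Taft hn hlam)ᵐᵒᵖ :=
  lift hn hlam (MulOpposite.op (g hn hlam ^ (n - 1)))
    (MulOpposite.op (-(g hn hlam ^ (n - 1) * x hn hlam)))
    (by rw [← MulOpposite.op_pow, ← pow_mul, mul_comm, pow_mul, g_pow, one_pow,
          MulOpposite.op_one])
    (by
      rw [← MulOpposite.op_pow, neg_pow,
        mul_pow_eq_zero_of_qcomm (mul_pow_of_qcomm (x_mul_g hn hlam) (n - 1)) (x_pow hn hlam),
        mul_zero, MulOpposite.op_zero])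
    (by
      have hl : lam * lam ^ (n - 1) = 1 := by
        rw [← pow_succ', Nat.sub_add_cancel hn.le, hlam.pow_eq_one]
      rw [← MulOpposite.op_mul, ← MulOpposite.op_mul, ← MulOpposite.op_smul]
      congr 1
      rw [mul_neg, neg_mul, smul_neg, mul_assoc (g hn hlam ^ (n - 1)) (x hn hlam),
        mul_pow_of_qcomm (x_mul_g hn hlam), mul_smul_comm, smul_smul, hl, one_smul])

@[simp] theorem comulHom_g : comulHom hn hlam (g hn hlam) = g hn hlam ⊗ₜ g hn hlam := by
  simp [comulHom]

@[simp] theorem comulHom_x :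
    comulHom hn hlam (x hn hlam) = g hn hlam ⊗ₜ x hn hlam + x hn hlam ⊗ₜ 1 := by
  simp [comulHom]

@[simp] theorem counitHom_g : counitHom hn hlam (g hn hlam) = 1 := by simp [counitHom]

@[simp] theorem counitHom_x : counitHom hn hlam (x hn hlam) = 0 := by simp [counitHom]

instance : Bialgebra k (Taft hn hlam) :=
  Bialgebra.ofAlgHom (comulHom hn hlam) (counitHom hn hlam)
    (by
      refine algHom_ext ?_ ?_
      · simp
      · simp [TensorProduct.add_tmul, TensorProduct.tmul_add, Algebra.TensorProduct.one_def,
          add_assoc])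
    (by refine algHom_ext ?_ ?_ <;> simp)
    (by refine algHom_ext ?_ ?_ <;> simp)

/-- The antipode as a linear map. -/
def antipodeLin : Taft hn hlam →ₗ[k] Taft hn hlam :=
  (MulOpposite.opLinearEquiv k).symm.toLinearMap ∘ₗ (antipodeHom hn hlam).toLinearMap

theorem antipodeLin_mul (a b : Taft hn hlam) :
    antipodeLin hn hlam (a * b) = antipodeLin hn hlam b * antipodeLin hn hlam a := by
  simp [antipodeLin]

theorem antipodeLin_one : antipodeLin hn hlam 1 = 1 := by
  simp [antipodeLin]

@[simp] theorem antipodeLin_g : antipodeLin hn hlam (g hn hlam) = g hn hlam ^ (n - 1) := by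
  simp [antipodeLin, antipodeHom]

@[simp] theorem antipodeLin_x :
    antipodeLin hn hlam (x hn hlam) = -(g hn hlam ^ (n - 1) * x hn hlam) := by
  simp [antipodeLin, antipodeHom]

theorem antipode_left (a : Taft hn hlam) :
    LinearMap.mul' k _ ((antipodeLin hn hlam).rTensor _ (comulHom hn hlam a)) =
      algebraMap k _ (counitHom hn hlam a) := by
  induction a using Taft.induction with
  | hc c =>
    rw [AlgHom.commutes, AlgHom.commutes, Algebra.TensorProduct.algebraMap_apply,
      LinearMap.rTensor_tmul, LinearMap.mul'_apply, mul_one, Algebra.algebraMap_eq_smul_one,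
      map_smul, antipodeLin_one, ← Algebra.algebraMap_eq_smul_one]
    rfl
  | hg => simp [g_pow_pred_mul]
  | hx => simp
  | hadd a b ha hb => simp only [map_add, ha, hb]
  | hmul a b ha hb =>
    have h1 : ∀ (p q : Taft hn hlam) (t : Taft hn hlam ⊗[k] Taft hn hlam),
        LinearMap.mul' k _ ((antipodeLin hn hlam).rTensor _ (t * (p ⊗ₜ q))) =
          antipodeLin hn hlam p *
            LinearMap.mul' k _ ((antipodeLin hn hlam).rTensor _ t) * q := by
      intro p q t
      induction t using TensorProduct.induction_on with
      | zero => simp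
      | add s t hs ht => simp only [add_mul, mul_add, map_add, hs, ht]
      | tmul c d => simp [antipodeLin_mul, mul_assoc]
    have h2 : ∀ t : Taft hn hlam ⊗[k] Taft hn hlam,
        LinearMap.mul' k _ ((antipodeLin hn hlam).rTensor _ (comulHom hn hlam a * t)) =
          algebraMap k _ (counitHom hn hlam a) *
            LinearMap.mul' k _ ((antipodeLin hn hlam).rTensor _ t) := by
      intro t
      induction t using TensorProduct.induction_on with
      | zero => simp
      | add s t hs ht => simp only [mul_add, map_add, hs, ht]
      | tmul c d =>
        rw [h1, ha, ← Algebra.commutes, mul_assoc]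
        simp
    rw [map_mul, h2, hb, map_mul, map_mul]

theorem antipode_right (a : Taft hn hlam) :
    LinearMap.mul' k _ ((antipodeLin hn hlam).lTensor _ (comulHom hn hlam a)) =
      algebraMap k _ (counitHom hn hlam a) := by
  induction a using Taft.induction with
  | hc c =>
    rw [AlgHom.commutes, AlgHom.commutes, Algebra.TensorProduct.algebraMap_apply,
      LinearMap.lTensor_tmul, LinearMap.mul'_apply, antipodeLin_one, mul_one]
    rfl
  | hg => simp [g_mul_pow_pred]
  | hx => simp [antipodeLin_one, ← mul_assoc, g_mul_pow_pred]
  | hadd a b ha hb => simp only [map_add, ha, hb]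
  | hmul a b ha hb =>
    have h1 : ∀ (p q : Taft hn hlam) (t : Taft hn hlam ⊗[k] Taft hn hlam),
        LinearMap.mul' k _ ((antipodeLin hn hlam).lTensor _ ((p ⊗ₜ q) * t)) =
          p * LinearMap.mul' k _ ((antipodeLin hn hlam).lTensor _ t) *
            antipodeLin hn hlam q := by
      intro p q t
      induction t using TensorProduct.induction_on with
      | zero => simp
      | add s t hs ht => simp only [add_mul, mul_add, map_add, hs, ht]
      | tmul c d => simp [antipodeLin_mul, mul_assoc]
    have h2 : ∀ t : Taft hn hlam ⊗[k] Taft hn hlam,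
        LinearMap.mul' k _ ((antipodeLin hn hlam).lTensor _ (t * comulHom hn hlam b)) =
          LinearMap.mul' k _ ((antipodeLin hn hlam).lTensor _ t) *
            algebraMap k _ (counitHom hn hlam b) := by
      intro t
      induction t using TensorProduct.induction_on with
      | zero => simp
      | add s t hs ht => simp only [add_mul, map_add, hs, ht]
      | tmul c d =>
        rw [h1, hb, mul_assoc, Algebra.commutes, ← mul_assoc]
        simp
    rw [map_mul, h2, ha, map_mul, map_mul]

instance : HopfAlgebra k (Taft hn hlam) where
  antipode := antipodeLin hn hlam
  mul_antipode_rTensor_comul := LinearMap.ext (antipode_left hn hlam)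
  mul_antipode_lTensor_comul := LinearMap.ext (antipode_right hn hlam)

end Taft

/-- An action of `H_n(λ)` on `k⟨u, v | u v - μ v u - κ⟩` is linear if
`g(u), g(v), x(u), x(v) ∈ k u + k v`. -/
def IsLinearAction {k : Type*} [Field k] {n : ℕ} {lam : k} {hn : 1 < n}
    {hlam : IsPrimitiveRoot lam n} {mu κ : k}
    (α : HopfAction k (Taft hn hlam) (QuantumAlgebra mu κ)) : Prop :=
  ∀ h ∈ ({Taft.g hn hlam, Taft.x hn hlam} : Set (Taft hn hlam)),
    ∀ w ∈ ({QuantumAlgebra.u mu κ, QuantumAlgebra.v mu κ} : Set (QuantumAlgebra mu κ)),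
      α.act h w ∈ Submodule.span k {QuantumAlgebra.u mu κ, QuantumAlgebra.v mu κ}

end

end TaftSmash

/-!
The algebras in question have the ordered monomials `u ^ i v ^ j` as a basis, and everything is
read off from this basis.

Since `μ ≠ 1`, the relation `u v = μ v u + κ` leaves little room for a linear action: up to
exchanging `u` and `v`, which replaces `μ` by `μ⁻¹` and rescales `κ`, one has `g u = μ u`,
`g v = λ μ v`, `x u = 0` and `x v = c u` with `c ≠ 0` (`exists_isTriangularAction`). Inner
faithfulness enters only through `c ≠ 0`: otherwise the Hopf ideal generated by `x` kills `A`.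
To make the two cases literally symmetric, the work is done for an arbitrary algebra with two
generators and both monomial bases (`IsQuantumPair`) and for an arbitrary scalar `κ`.

In this normal form `μ ^ n = 1`, and `x v ^ j` is `c (1 + λ + ⋯ + λ ^ (j - 1)) u v ^ (j - 1)` plus
a multiple of `v ^ (j - 2)` that vanishes when `n ∣ j`. Hence the kernel of `x` is spanned by the
`u ^ i v ^ j` with `n ∣ j`, and the invariants of `g` in it by those with moreover `m ∣ i`
(`IsTriangularAction.fixedRing_eq`). As `u ^ m` and `v ^ n` commute, they generate a polynomial ring.

For primeness, `A # H` is compared with its action on `A`.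

* If `m = n`, this action is faithful (`IsTriangularAction.smashRep_faithful`), and each nonzero
  submodule of `A` contains a nonzero element of `A ^ H`, which is central and regular in `A`.
  These two facts imply that `A # H` is prime (`HopfAction.isPrimeRing_of_faithful`).
* If `m < n`, then `κ = 0`, since otherwise `λ μ ^ 2 = 1` gives `n ∣ m`. In this case an explicit
  nonzero element of `A # H` kills `A` (`IsTriangularAction.exists_annihilator`). As `H` has a
  nonzero left integral `t`, the left ideal `A # t` is a copy of `A`, so the annihilator of `A`
  kills a nonzero left ideal and `A # H` is not prime (`HopfAction.not_isPrimeRing_of_integral`).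
-/

namespace TaftSmash

noncomputable section

/-! ### Quantum pairs and their monomial bases -/

/-- The elements `u`, `v` generate the algebra `A`, satisfy `u v = μ v u + κ`, and both families
of ordered monomials, `u ^ i v ^ j` and `v ^ i u ^ j`, are linearly independent. The scalar `κ` is
arbitrary, so that the notion is stable under exchanging `u` and `v`, see `IsQuantumPair.swap`. -/
structure IsQuantumPair {k A : Type*} [Field k] [Ring A] [Algebra k A] (mu κ : k) (u v : A) :
    Prop where
  rel : u * v = mu • (v * u) + κ • (1 : A)
  adjoin_eq_top : Algebra.adjoin k {u, v} = ⊤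
  indep : LinearIndependent k fun p : ℕ × ℕ => u ^ p.1 * v ^ p.2
  indep' : LinearIndependent k fun p : ℕ × ℕ => v ^ p.1 * u ^ p.2

section PBW

variable {k : Type*} [Field k]

theorem geom_sum_eq_zero {mu : k} {j : ℕ} (h1 : mu ≠ 1) (hj : mu ^ j = 1) :
    ∑ l ∈ Finset.range j, mu ^ l = 0 := by
  have := mul_geom_sum mu j
  rw [hj, sub_self] at this
  exact (mul_eq_zero.1 this).resolve_left (sub_ne_zero.2 h1)

/-- Operators `U`, `V` satisfying the defining relation, on the space with basis `e_{ij}` in the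
role of the ordered monomials `v ^ i u ^ j`: `V e_{ij} = e_{i+1,j}` and
`U e_{ij} = μ ^ i e_{i,j+1} + κ (1 + ⋯ + μ ^ (i - 1)) e_{i-1,j}`. They show that the ordered
monomials are linearly independent. -/
theorem exists_normal_form_operators (mu κ : k) :
    ∃ U V : Module.End k (ℕ × ℕ →₀ k), U * V = mu • (V * U) + κ • 1 ∧
      ∀ p : ℕ × ℕ, (V ^ p.1 * U ^ p.2) (Finsupp.single (0, 0) 1) = Finsupp.single p 1 := by
  let V : Module.End k (ℕ × ℕ →₀ k) :=
    Finsupp.linearCombination k fun p : ℕ × ℕ => Finsupp.single (p.1 + 1, p.2) (1 : k)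
  let U : Module.End k (ℕ × ℕ →₀ k) :=
    Finsupp.linearCombination k fun p : ℕ × ℕ => Finsupp.single (p.1, p.2 + 1) (mu ^ p.1) +
      Finsupp.single (p.1 - 1, p.2) (κ * ∑ l ∈ Finset.range p.1, mu ^ l)
  have hV : ∀ i j, V (Finsupp.single (i, j) 1) = Finsupp.single (i + 1, j) 1 := by
    intro i j; simp [V]
  have hU : ∀ i j, U (Finsupp.single (i, j) 1) = Finsupp.single (i, j + 1) (mu ^ i) +
      Finsupp.single (i - 1, j) (κ * ∑ l ∈ Finset.range i, mu ^ l) := by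
    intro i j; simp [U]
  have hs : ∀ (p : ℕ × ℕ) (a : k), Finsupp.single p a = a • Finsupp.single p 1 := by
    intro p a; simp
  refine ⟨U, V, ?_, ?_⟩
  · refine Finsupp.basisSingleOne.ext fun p => ?_
    obtain ⟨i, j⟩ := p
    simp only [Finsupp.coe_basisSingleOne, Module.End.mul_apply, LinearMap.add_apply,
      LinearMap.smul_apply, Module.End.one_apply, hV, hU, map_add, Nat.add_sub_cancel]
    rw [hs _ (mu ^ i), hs _ (κ * _), hs _ (mu ^ (i + 1)), hs _ (κ * _)]
    simp only [map_smul, hV]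
    rcases i with _ | i
    · simp
    · rw [Finset.sum_range_succ' _ (i + 1)]
      simp only [Nat.add_sub_cancel, pow_zero, pow_succ _ (i + 1), pow_succ', ← Finset.mul_sum]
      module
  · rintro ⟨i, j⟩
    have h1 : ∀ j, (U ^ j) (Finsupp.single (0, 0) 1) = Finsupp.single (0, j) 1 := by
      intro j
      induction j with
      | zero => simp
      | succ j ih => rw [pow_succ', Module.End.mul_apply, ih, hU]; simp
    have h2 : ∀ i, (V ^ i) (Finsupp.single (0, j) 1) = Finsupp.single (i, j) 1 := by
      intro i
      induction i with
      | zero => simp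
      | succ i ih => rw [pow_succ', Module.End.mul_apply, ih, hV]
    rw [Module.End.mul_apply, h1, h2]

namespace QuantumAlgebra

variable (mu κ : k)

theorem u_mul_v : u mu κ * v mu κ = mu • (v mu κ * u mu κ) + κ • 1 := by
  have := RingQuot.mkAlgHom_rel k (QuantumRel.rel (mu := mu) (κ := κ))
  rw [map_sub, map_sub, map_smul, map_mul, map_mul, map_zero, AlgHom.commutes,
    Algebra.algebraMap_eq_smul_one] at this
  exact (sub_eq_iff_eq_add.1 (sub_eq_zero.1 this)).trans (add_comm _ _)

theorem adjoin_u_v : Algebra.adjoin k {u mu κ, v mu κ} = ⊤ := by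
  have h : Algebra.adjoin k (Set.range (FreeAlgebra.ι k : UV → FreeAlgebra k UV)) = ⊤ :=
    FreeAlgebra.adjoin_range_ι k UV
  have h2 := congrArg (Subalgebra.map (RingQuot.mkAlgHom k (QuantumRel mu κ))) h
  rw [AlgHom.map_adjoin, Algebra.map_top, (AlgHom.range_eq_top _).2
    (RingQuot.mkAlgHom_surjective k (QuantumRel mu κ))] at h2
  refine (congrArg _ ?_).trans h2
  ext a
  constructor
  · rintro (rfl | rfl)
    · exact ⟨_, ⟨UV.u, rfl⟩, rfl⟩
    · exact ⟨_, ⟨UV.v, rfl⟩, rfl⟩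
  · rintro ⟨_, ⟨i, rfl⟩, rfl⟩
    cases i
    · exact Or.inl rfl
    · exact Or.inr rfl

variable {mu κ}

theorem exists_algHom {B : Type*} [Ring B] [Algebra k B] (U V : B)
    (h : U * V = mu • (V * U) + κ • 1) :
    ∃ f : QuantumAlgebra mu κ →ₐ[k] B, f (u mu κ) = U ∧ f (v mu κ) = V := by
  refine ⟨RingQuot.liftAlgHom k ⟨FreeAlgebra.lift k
    (fun i => match i with | UV.u => U | UV.v => V), ?_⟩, ?_, ?_⟩
  · intro a b hab
    cases hab
    simp [h, Algebra.algebraMap_eq_smul_one]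
  · refine (RingQuot.liftAlgHom_mkAlgHom_apply k _ _ _).trans ?_
    simp
  · refine (RingQuot.liftAlgHom_mkAlgHom_apply k _ _ _).trans ?_
    simp

theorem linearIndependent_monomials_of_operators {A : Type*} [Ring A] [Algebra k A] {u v : A}
    (f : A →ₐ[k] Module.End k (ℕ × ℕ →₀ k))
    (h : ∀ p : ℕ × ℕ, (f v ^ p.1 * f u ^ p.2) (Finsupp.single (0, 0) 1) = Finsupp.single p 1) :
    LinearIndependent k fun p : ℕ × ℕ => v ^ p.1 * u ^ p.2 := by
  refine LinearIndependent.of_comp ((LinearMap.applyₗ (Finsupp.single (0, 0) 1)).comp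
    f.toLinearMap) ?_
  convert Finsupp.linearIndependent_single_one k (ℕ × ℕ) using 2 with p
  simpa using h p

theorem isQuantumPair (hmu : mu ≠ 0) : IsQuantumPair mu κ (u mu κ) (v mu κ) where
  rel := u_mul_v mu κ
  adjoin_eq_top := adjoin_u_v mu κ
  indep' := by
    obtain ⟨U, V, h, hp⟩ := exists_normal_form_operators mu κ
    obtain ⟨f, rfl, rfl⟩ := exists_algHom U V h
    exact linearIndependent_monomials_of_operators f hp
  indep := by
    obtain ⟨V, U, h, hp⟩ := exists_normal_form_operators mu⁻¹ (-mu⁻¹ * κ)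
    obtain ⟨f, rfl, rfl⟩ := exists_algHom (mu := mu) (κ := κ) U V (by
      rw [h, smul_add, smul_smul, smul_smul, mul_inv_cancel₀ hmu, neg_mul, mul_neg,
        mul_inv_cancel_left₀ hmu]
      module)
    exact linearIndependent_monomials_of_operators f hp

end QuantumAlgebra

namespace IsQuantumPair

variable {A : Type*} [Ring A] [Algebra k A] {mu κ : k} {u v : A}

theorem v_mul_u (h : IsQuantumPair mu κ u v) (hmu : mu ≠ 0) :
    v * u = mu⁻¹ • (u * v) - (mu⁻¹ * κ) • (1 : A) := by
  rw [h.rel, smul_add, smul_smul, smul_smul, inv_mul_cancel₀ hmu]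
  module

theorem swap (h : IsQuantumPair mu κ u v) (hmu : mu ≠ 0) :
    IsQuantumPair mu⁻¹ (-mu⁻¹ * κ) v u where
  rel := by rw [h.v_mul_u hmu]; module
  adjoin_eq_top := by rw [Set.pair_comm]; exact h.adjoin_eq_top
  indep := h.indep'
  indep' := h.indep

theorem u_mul_v_pow (h : IsQuantumPair mu κ u v) (j : ℕ) :
    u * v ^ (j + 1) = mu ^ (j + 1) • (v ^ (j + 1) * u) +
      (κ * ∑ l ∈ Finset.range (j + 1), mu ^ l) • v ^ j := by
  induction j with
  | zero => simp [h.rel]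
  | succ j ih =>
    rw [pow_succ v, ← mul_assoc, ih, add_mul, smul_mul_assoc, mul_assoc, h.rel,
      Finset.sum_range_succ _ (j + 1), smul_mul_assoc, ← pow_succ, mul_add, mul_smul_comm,
      mul_smul_comm, mul_one, ← mul_assoc, pow_succ mu (j + 1)]
    module

theorem span_eq_top (h : IsQuantumPair mu κ u v) (hmu : mu ≠ 0) :
    ⊤ ≤ Submodule.span k (Set.range fun p : ℕ × ℕ => u ^ p.1 * v ^ p.2) := by
  set S := Submodule.span k (Set.range fun p : ℕ × ℕ => u ^ p.1 * v ^ p.2) with hS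
  have hmem : ∀ i j : ℕ, u ^ i * v ^ j ∈ S := fun i j => Submodule.subset_span ⟨(i, j), rfl⟩
  have hu : ∀ s ∈ S, u * s ∈ S := by
    intro s hs
    induction hs using Submodule.span_induction with
    | mem s hs =>
      obtain ⟨⟨i, j⟩, rfl⟩ := hs
      rw [← mul_assoc, ← pow_succ']
      exact hmem _ _
    | zero => simp
    | add a b _ _ ha hb => rw [mul_add]; exact S.add_mem ha hb
    | smul c a _ ha => rw [mul_smul_comm]; exact S.smul_mem c ha
  have hv : ∀ s ∈ S, v * s ∈ S := by
    intro s hs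
    induction hs using Submodule.span_induction with
    | mem s hs =>
      obtain ⟨⟨i, j⟩, rfl⟩ := hs
      cases i with
      | zero => simpa [← pow_succ'] using hmem 0 (j + 1)
      | succ i =>
        rw [← mul_assoc, (h.swap hmu).u_mul_v_pow i, add_mul, smul_mul_assoc, mul_assoc,
          ← pow_succ', smul_mul_assoc]
        exact S.add_mem (S.smul_mem _ (hmem _ _)) (S.smul_mem _ (hmem _ _))
    | zero => simp
    | add a b _ _ ha hb => rw [mul_add]; exact S.add_mem ha hb
    | smul c a _ ha => rw [mul_smul_comm]; exact S.smul_mem c ha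
  have key : ∀ a ∈ Algebra.adjoin k {u, v}, ∀ s ∈ S, a * s ∈ S := by
    intro a ha
    induction ha using Algebra.adjoin_induction with
    | mem a ha =>
      rcases ha with rfl | rfl
      exacts [hu, hv]
    | algebraMap r =>
      intro s hs
      rw [← Algebra.smul_def]
      exact S.smul_mem r hs
    | add a b _ _ ha hb =>
      intro s hs
      rw [add_mul]
      exact S.add_mem (ha s hs) (hb s hs)
    | mul a b _ _ ha hb =>
      intro s hs
      rw [mul_assoc]
      exact ha _ (hb s hs)
  intro a _
  have := key a (by rw [h.adjoin_eq_top]; trivial) 1 (by simpa using hmem 0 0)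
  rwa [mul_one] at this

/-- The basis of ordered monomials `u ^ i v ^ j`. -/
def basis (h : IsQuantumPair mu κ u v) (hmu : mu ≠ 0) : Module.Basis (ℕ × ℕ) k A :=
  Module.Basis.mk h.indep (h.span_eq_top hmu)

theorem basis_apply (h : IsQuantumPair mu κ u v) (hmu : mu ≠ 0) (p : ℕ × ℕ) :
    h.basis hmu p = u ^ p.1 * v ^ p.2 := by
  simp [basis]

theorem nontrivial (h : IsQuantumPair mu κ u v) : Nontrivial A :=
  ⟨⟨_, 0, h.indep.ne_zero (0, 0)⟩⟩

/-- Comparing the coefficients of an ordered polynomial of degree at most two. -/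
theorem coeff_eq_zero (h : IsQuantumPair mu κ u v) {a b c d e f : k}
    (h0 : a • (u * u) + b • (u * v) + c • (v * v) + d • u + e • v + f • (1 : A) = 0) :
    a = 0 ∧ b = 0 ∧ c = 0 ∧ d = 0 ∧ e = 0 ∧ f = 0 := by
  have h1 := h.indep
  rw [linearIndependent_iff] at h1
  have h2 := h1 (Finsupp.single (2, 0) a + Finsupp.single (1, 1) b + Finsupp.single (0, 2) c +
    Finsupp.single (1, 0) d + Finsupp.single (0, 1) e + Finsupp.single (0, 0) f)
    (by simpa [map_add, pow_two] using h0)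
  have h3 := fun p => DFunLike.congr_fun h2 p
  refine ⟨?_, ?_, ?_, ?_, ?_, ?_⟩
  · simpa using h3 (2, 0)
  · simpa using h3 (1, 1)
  · simpa using h3 (0, 2)
  · simpa using h3 (1, 0)
  · simpa using h3 (0, 1)
  · simpa using h3 (0, 0)

theorem u_mul_cancel (h : IsQuantumPair mu κ u v) (hmu : mu ≠ 0) {a : A} (ha : u * a = 0) :
    a = 0 := by
  refine (h.basis hmu).ext_elem fun p => ?_
  have : ((h.basis hmu).coord (p.1 + 1, p.2)).comp (LinearMap.mulLeft k u) =
      (h.basis hmu).coord p := by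
    refine (h.basis hmu).ext fun q => ?_
    have : u * (u ^ q.1 * v ^ q.2) = h.basis hmu (q.1 + 1, q.2) := by
      rw [h.basis_apply, ← mul_assoc, ← pow_succ']
    rw [LinearMap.comp_apply, LinearMap.mulLeft_apply, basis_apply, this, ← h.basis_apply hmu]
    simp [Finsupp.single_apply, Prod.ext_iff]
  have h2 := LinearMap.congr_fun this a
  rw [LinearMap.comp_apply, LinearMap.mulLeft_apply, ha, map_zero] at h2
  simpa using h2.symm

theorem u_pow_mul_cancel (h : IsQuantumPair mu κ u v) (hmu : mu ≠ 0) {a : A} (l : ℕ)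
    (ha : u ^ l * a = 0) : a = 0 := by
  induction l with
  | zero => simpa using ha
  | succ l ih => rw [pow_succ', mul_assoc] at ha; exact ih (h.u_mul_cancel hmu ha)

theorem commute_v_pow (h : IsQuantumPair mu κ u v) (h1 : mu ≠ 1) {j : ℕ} (hj : mu ^ j = 1) :
    Commute u (v ^ j) := by
  cases j with
  | zero => simp
  | succ j =>
    rw [Commute, SemiconjBy, h.u_mul_v_pow, hj, geom_sum_eq_zero h1 hj]
    simp

theorem commute_of_commute_gens (h : IsQuantumPair mu κ u v) {z : A} (hu : Commute u z)
    (hv : Commute v z) (a : A) : Commute a z := by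
  have ha : a ∈ Algebra.adjoin k {u, v} := by rw [h.adjoin_eq_top]; trivial
  induction ha using Algebra.adjoin_induction with
  | mem a ha =>
    rcases ha with rfl | rfl
    exacts [hu, hv]
  | algebraMap r => exact Algebra.commutes r z
  | add a b _ _ ha hb => exact ha.add_left hb
  | mul a b _ _ ha hb => exact ha.mul_left hb

theorem commute_u_pow (h : IsQuantumPair mu κ u v) (h0 : mu ≠ 0) (h1 : mu ≠ 1) {j : ℕ}
    (hj : mu ^ j = 1) (a : A) : Commute a (u ^ j) :=
  h.commute_of_commute_gens (Commute.self_pow u j)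
    ((h.swap h0).commute_v_pow (by simpa using h1) (by simp [hj])) a

theorem mul_u_pow_cancel (h : IsQuantumPair mu κ u v) (h0 : mu ≠ 0) (h1 : mu ≠ 1) {j : ℕ}
    (hj : mu ^ j = 1) (hj0 : 0 < j) {a : A} (l : ℕ) (ha : a * u ^ l = 0) : a = 0 := by
  refine h.u_pow_mul_cancel h0 (j * l) ?_
  rw [pow_mul, ← ((h.commute_u_pow h0 h1 hj a).pow_right l).eq, ← pow_mul,
    ← Nat.sub_add_cancel (Nat.le_mul_of_pos_left l hj0), pow_add, pow_mul_comm,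
    ← mul_assoc, ha, zero_mul]

end IsQuantumPair

end PBW

/-! ### Representations of the smash product -/

namespace HopfAction

open Coalgebra

variable {k H A : Type*} [Field k] [Ring H] [HopfAlgebra k H] [Ring A] [Algebra k A]
  (α : HopfAction k H A)

/-- A representation `β` of `H` on `A` is compatible with the action `α` if
`β(h)(a b) = ∑ (h₁ · a) β(h₂)(b)`; this makes `A`, with `β`, a module over `A # H`. -/
def IsCompatible (β : H →ₐ[k] Module.End k A) : Prop :=
  ∀ (h : H) (a b : A), β h (a * b) = LinearMap.mul' k A
    (TensorProduct.map (α.act.toLinearMap.flip a) (β.toLinearMap.flip b) (comul (R := k) h))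

theorem isCompatible_act : α.IsCompatible α.act := α.act_mul

variable {α} in
theorem IsCompatible.mul_sum {β : H →ₐ[k] Module.End k A} (hβ : α.IsCompatible β) (h : H) (a b : A)
    {ι : Type*} (r : Coalgebra.Repr k h ι) :
    β h (a * b) = ∑ i ∈ r.index, α.act (r.left i) a * β (r.right i) b := by
  rw [hβ h, ← r.eq]
  simp [map_sum]

/-- The operator `b ↦ a (β(h) b)` attached to `a # h`, extended linearly to `A # H`. -/
def smashRep (β : H →ₐ[k] Module.End k A) : α.SmashProduct →ₗ[k] Module.End k A :=
  LinearMap.mul' k (Module.End k A) ∘ₗ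
    TensorProduct.map (Algebra.lmul k A).toLinearMap β.toLinearMap

@[simp] theorem smashRep_mk (β : H →ₐ[k] Module.End k A) (a : A) (h : H) (b : A) :
    α.smashRep β (SmashProduct.mk α a h) b = a * β h b := rfl

theorem SmashProduct.induction {P : α.SmashProduct → Prop} (h0 : P 0)
    (hmk : ∀ a h, P (SmashProduct.mk α a h)) (hadd : ∀ r s, P r → P s → P (r + s))
    (r : α.SmashProduct) : P r :=
  TensorProduct.induction_on r h0 hmk hadd

theorem SmashProduct.mk_sum_left {ι : Type*} (s : Finset ι) (a : ι → A) (h : H) :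
    SmashProduct.mk α (∑ i ∈ s, a i) h = ∑ i ∈ s, SmashProduct.mk α (a i) h :=
  TensorProduct.sum_tmul s a h

theorem SmashProduct.mk_sum_right {ι : Type*} (s : Finset ι) (a : A) (h : ι → H) :
    SmashProduct.mk α a (∑ i ∈ s, h i) = ∑ i ∈ s, SmashProduct.mk α a (h i) :=
  TensorProduct.tmul_sum a s h

theorem SmashProduct.mk_smul_right (c : k) (a : A) (h : H) :
    SmashProduct.mk α a (c • h) = SmashProduct.mk α (c • a) h :=
  (TensorProduct.smul_tmul c a h).symm

theorem SmashProduct.mk_add_left (a b : A) (h : H) :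
    SmashProduct.mk α (a + b) h = SmashProduct.mk α a h + SmashProduct.mk α b h :=
  TensorProduct.add_tmul a b h

theorem SmashProduct.mk_zero_left (h : H) : SmashProduct.mk α 0 h = 0 :=
  TensorProduct.zero_tmul A h

theorem smashRep_mul {β : H →ₐ[k] Module.End k A} (hβ : α.IsCompatible β)
    (r s : α.SmashProduct) : α.smashRep β (r * s) = α.smashRep β r * α.smashRep β s := by
  induction r using SmashProduct.induction with
  | h0 => simp
  | hadd r r' hr hr' => rw [add_mul, map_add, hr, hr', map_add, add_mul]
  | hmk a h =>
    induction s using SmashProduct.induction with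
    | h0 => simp
    | hadd s s' hs hs' => rw [mul_add, map_add, hs, hs', map_add, mul_add]
    | hmk b h' =>
      ext p
      rw [SmashProduct.mk_mul_mk α a b h h' (Coalgebra.Repr.arbitrary k h), map_sum,
        Module.End.mul_apply, smashRep_mk, smashRep_mk,
        hβ.mul_sum h b _ (Coalgebra.Repr.arbitrary k h), Finset.mul_sum, LinearMap.sum_apply]
      refine Finset.sum_congr rfl fun i _ => ?_
      rw [smashRep_mk, map_mul, Module.End.mul_apply, mul_assoc]

theorem smashRep_one (β : H →ₐ[k] Module.End k A) : α.smashRep β 1 = 1 := by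
  ext p
  rw [SmashProduct.one_def, smashRep_mk, map_one, one_mul]

theorem smashRep_pow {β : H →ₐ[k] Module.End k A} (hβ : α.IsCompatible β)
    (r : α.SmashProduct) (j : ℕ) : α.smashRep β (r ^ j) = α.smashRep β r ^ j := by
  induction j with
  | zero => rw [pow_zero, pow_zero, smashRep_one]
  | succ j ih => rw [pow_succ, pow_succ, smashRep_mul α hβ, ih]

/-- Every element of `A # H` acts on `A` by right `A^H`-linear operators. -/
theorem smashRep_mul_fixed {z : A} (hz : z ∈ α.fixedRing) (r : α.SmashProduct) (p : A) :
    α.smashRep α.act r (p * z) = α.smashRep α.act r p * z := by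
  induction r using SmashProduct.induction with
  | h0 => simp
  | hadd r r' hr hr' => rw [map_add, LinearMap.add_apply, hr, hr', LinearMap.add_apply, add_mul]
  | hmk a h =>
    rw [smashRep_mk, smashRep_mk, α.act_mul_sum h p z (Coalgebra.Repr.arbitrary k h), mul_assoc]
    congr 1
    have h1 := Coalgebra.sum_tmul_counit_eq (R := k) (Coalgebra.Repr.arbitrary k h)
    have h2 := congrArg (fun t => (TensorProduct.rid k H t)) h1
    simp only [map_sum, TensorProduct.rid_tmul, one_smul] at h2
    conv_rhs => rw [← h2]
    rw [map_sum, LinearMap.sum_apply, Finset.sum_mul]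
    refine Finset.sum_congr rfl fun i _ => ?_
    rw [hz, map_smul, LinearMap.smul_apply, mul_smul_comm, smul_mul_assoc]

/-- If `t` is a left integral of `H`, then `A # t` is isomorphic to `A` as a left module. -/
theorem mul_mk_integral {t : H} (ht : ∀ h : H, h * t = counit (R := k) h • t)
    (r : α.SmashProduct) (p : A) :
    r * SmashProduct.mk α p t = SmashProduct.mk α (α.smashRep α.act r p) t := by
  induction r using SmashProduct.induction with
  | h0 => rw [zero_mul, map_zero, LinearMap.zero_apply, SmashProduct.mk_zero_left]
  | hadd r r' hr hr' =>
    rw [add_mul, hr, hr', map_add, LinearMap.add_apply, SmashProduct.mk_add_left]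
  | hmk a h =>
    rw [SmashProduct.mk_mul_mk α a p h t (Coalgebra.Repr.arbitrary k h), smashRep_mk]
    have h1 := Coalgebra.sum_tmul_counit_eq (R := k) (Coalgebra.Repr.arbitrary k h)
    have h2 := congrArg (fun t => (TensorProduct.rid k H t)) h1
    simp only [map_sum, TensorProduct.rid_tmul, one_smul] at h2
    conv_rhs => rw [← h2]
    rw [map_sum, LinearMap.sum_apply, Finset.mul_sum, SmashProduct.mk_sum_left]
    refine Finset.sum_congr rfl fun i _ => ?_
    rw [ht, SmashProduct.mk_smul_right, map_smul, LinearMap.smul_apply, mul_smul_comm]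

/-- If `A` is not faithful over `A # H` and `H` has a nonzero left integral `t`, then `A # H` is
not prime: the annihilator of `A` kills the left ideal `A # t`. -/
theorem not_isPrimeRing_of_integral {t : H} (ht : ∀ h : H, h * t = counit (R := k) h • t)
    (ht0 : SmashProduct.mk α 1 t ≠ 0) {r : α.SmashProduct} (hr : r ≠ 0)
    (hr0 : α.smashRep α.act r = 0) : ¬ IsPrimeRing α.SmashProduct := by
  rintro ⟨-, h⟩
  refine (h r (SmashProduct.mk α 1 t) fun s => ?_).elim hr ht0
  rw [mul_assoc, α.mul_mk_integral ht, α.mul_mk_integral ht, hr0, LinearMap.zero_apply,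
    SmashProduct.mk_zero_left]

/-- If `A` is faithful over `A # H` and each nonzero `A # H`-submodule of `A` meets `A^H` in a
right regular element of `A`, then `A # H` is prime. -/
theorem isPrimeRing_of_faithful [Nontrivial A]
    (hfaith : ∀ r : α.SmashProduct, α.smashRep α.act r = 0 → r = 0)
    (hfix : ∀ p : A, p ≠ 0 → ∃ r : α.SmashProduct, α.smashRep α.act r p ∈ α.fixedRing ∧
      ∀ q : A, q * α.smashRep α.act r p = 0 → q = 0) : IsPrimeRing α.SmashProduct := by
  refine ⟨⟨⟨1, 0, fun h => ?_⟩⟩, fun a b hab => ?_⟩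
  · have := LinearMap.congr_fun (congrArg (α.smashRep α.act) h) 1
    rw [smashRep_one, map_zero] at this
    exact one_ne_zero this
  · by_contra! hne
    obtain ⟨ha, hb⟩ := hne
    have : ∃ f, α.smashRep α.act b f ≠ 0 := by
      by_contra! hf
      exact hb (hfaith b (LinearMap.ext hf))
    obtain ⟨f, hf⟩ := this
    obtain ⟨r, hr, hreg⟩ := hfix _ hf
    refine ha (hfaith a (LinearMap.ext fun p => hreg _ ?_))
    rw [← α.smashRep_mul_fixed hr]
    have h1 := hab (SmashProduct.mk α p 1 * r)
    have h2 := LinearMap.congr_fun (congrArg (α.smashRep α.act) h1) f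
    rw [smashRep_mul α α.isCompatible_act, smashRep_mul α α.isCompatible_act,
      smashRep_mul α α.isCompatible_act, map_zero] at h2
    simpa using h2

end HopfAction

/-! ### Actions of Taft algebras -/

namespace Taft

open Coalgebra

variable {k : Type*} [Field k] {n : ℕ} {lam : k} {hn : 1 < n} {hlam : IsPrimitiveRoot lam n}

theorem comul_g : comul (R := k) (g hn hlam) = g hn hlam ⊗ₜ g hn hlam := comulHom_g hn hlam

theorem comul_x :
    comul (R := k) (x hn hlam) = g hn hlam ⊗ₜ x hn hlam + x hn hlam ⊗ₜ 1 := comulHom_x hn hlam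

theorem counit_g : counit (R := k) (g hn hlam) = 1 := counitHom_g hn hlam

theorem counit_x : counit (R := k) (x hn hlam) = 0 := counitHom_x hn hlam

theorem x_mul_g_pow (j : ℕ) :
    x hn hlam * g hn hlam ^ j = lam ^ j • (g hn hlam ^ j * x hn hlam) :=
  mul_pow_of_qcomm (x_mul_g hn hlam) j

theorem x_ne_zero : x hn hlam ≠ 0 := by
  intro h0
  let G : Matrix (Fin 2) (Fin 2) k := !![1, 0; 0, lam]
  let X : Matrix (Fin 2) (Fin 2) k := !![0, 1; 0, 0]
  have hG : ∀ j : ℕ, G ^ j = !![1, 0; 0, lam ^ j] := by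
    intro j
    induction j with
    | zero => simp [Matrix.one_fin_two]
    | succ j ih => rw [pow_succ, ih]; simp [G, pow_succ]
  have h1 : G ^ n = 1 := by rw [hG, hlam.pow_eq_one, Matrix.one_fin_two]
  have h2 : X ^ n = 0 := by
    have : X ^ 2 = 0 := by
      rw [pow_two]
      ext i j
      fin_cases i <;> fin_cases j <;> simp [X]
    exact pow_eq_zero_of_le hn this
  have h3 : X * G = lam • (G * X) := by
    ext i j
    fin_cases i <;> fin_cases j <;> simp [X, G]
  have h4 := lift_x hn hlam G X h1 h2 h3
  rw [h0, map_zero] at h4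
  have := congrFun (congrFun h4 0) 1
  simp [X] at this

/-- The Hopf algebra projection of `H_n(λ)` onto its group algebra, `g ↦ g`, `x ↦ 0`. -/
def proj : Taft hn hlam →ₐ[k] Taft hn hlam :=
  lift hn hlam (g hn hlam) 0 (g_pow hn hlam) (zero_pow (by omega)) (by simp)

@[simp] theorem proj_g : proj (g hn hlam) = g hn hlam := by simp [proj]

@[simp] theorem proj_x : proj (x hn hlam) = 0 := by simp [proj]

/-- The kernel of the projection onto the group algebra, that is, the ideal generated by `x`. -/
theorem isHopfIdeal_ker_proj :
    (RingHom.ker (proj (hn := hn) (hlam := hlam))).IsHopfIdeal k := by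
  set I := RingHom.ker (proj (hn := hn) (hlam := hlam)) with hI
  have hx : x hn hlam ∈ I := RingHom.mem_ker.2 proj_x
  refine @Ideal.IsHopfIdeal.mk _ _ _ _ _ _ ⟨fun h hh => ?_, fun h hh => ?_⟩ fun h hh => ?_
  · have : (counitHom hn hlam).comp proj = counitHom hn hlam := algHom_ext (by simp) (by simp)
    have h2 := DFunLike.congr_fun this h
    rw [AlgHom.comp_apply, RingHom.mem_ker.1 hh, map_zero] at h2
    exact h2.symm
  · let q : Taft hn hlam →ₐ[k] Taft hn hlam ⧸ I := Ideal.Quotient.mkₐ k I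
    have hqx : q (x hn hlam) = 0 := Ideal.Quotient.eq_zero_iff_mem.2 hx
    let F := (Algebra.TensorProduct.map q q).comp (comulHom hn hlam)
    have : F.comp proj = F := by
      refine algHom_ext ?_ ?_
      · simp
      · simp [F, hqx]
    have h2 := DFunLike.congr_fun this h
    rw [AlgHom.comp_apply, RingHom.mem_ker.1 hh, map_zero] at h2
    exact h2.symm
  · have : (antipodeHom hn hlam).comp proj = (AlgHom.op proj).comp (antipodeHom hn hlam) := by
      refine algHom_ext ?_ ?_
      · simp [antipodeHom]
      · simp [antipodeHom]
    have h2 := DFunLike.congr_fun this h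
    rw [AlgHom.comp_apply, RingHom.mem_ker.1 hh, map_zero] at h2
    have h3 := congrArg MulOpposite.unop h2
    exact RingHom.mem_ker.2 h3.symm

variable {A : Type*} [Ring A] [Algebra k A] (α : HopfAction k (Taft hn hlam) A)

theorem act_g_mul (a b : A) :
    α.act (g hn hlam) (a * b) = α.act (g hn hlam) a * α.act (g hn hlam) b := by
  rw [α.act_mul, comul_g]
  simp

theorem act_x_mul (a b : A) : α.act (x hn hlam) (a * b) =
    α.act (g hn hlam) a * α.act (x hn hlam) b + α.act (x hn hlam) a * b := by
  rw [α.act_mul, comul_x]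
  simp

theorem act_g_one : α.act (g hn hlam) 1 = 1 := by rw [α.act_one, counit_g, one_smul]

theorem act_x_one : α.act (x hn hlam) 1 = 0 := by rw [α.act_one, counit_x, zero_smul]

theorem act_g_pow (a : A) (j : ℕ) :
    α.act (g hn hlam) (a ^ j) = α.act (g hn hlam) a ^ j := by
  induction j with
  | zero => rw [pow_zero, pow_zero, act_g_one]
  | succ j ih => rw [pow_succ, pow_succ, act_g_mul, ih]

theorem act_x_act_g (a : A) : α.act (x hn hlam) (α.act (g hn hlam) a) =
    lam • α.act (g hn hlam) (α.act (x hn hlam) a) := by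
  rw [← Module.End.mul_apply, ← map_mul, x_mul_g, map_smul, map_mul]
  rfl

theorem act_g_iterate (a : A) : (α.act (g hn hlam) ^ n) a = a := by
  rw [← map_pow, g_pow, map_one, Module.End.one_apply]

theorem act_x_iterate (a : A) : (α.act (x hn hlam) ^ n) a = 0 := by
  rw [← map_pow, x_pow, map_zero, LinearMap.zero_apply]

theorem act_g_injective {a : A} (h : α.act (g hn hlam) a = 0) : a = 0 := by
  have h1 : α.act (g hn hlam ^ (n - 1)) (α.act (g hn hlam) a) = a := by
    rw [← Module.End.mul_apply, ← map_mul, g_pow_pred_mul, map_one, Module.End.one_apply]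
  rw [← h1, h, map_zero]

theorem mem_fixedRing_iff {a : A} :
    a ∈ α.fixedRing ↔ α.act (g hn hlam) a = a ∧ α.act (x hn hlam) a = 0 := by
  constructor
  · intro h
    exact ⟨by rw [h (g hn hlam), counit_g, one_smul], by rw [h (x hn hlam), counit_x, zero_smul]⟩
  · rintro ⟨hg, hx⟩ h
    induction h using Taft.induction with
    | hc c =>
      rw [AlgHom.commutes, Module.algebraMap_end_apply, Bialgebra.counit_algebraMap]
    | hg => rw [hg, counit_g, one_smul]
    | hx => rw [hx, counit_x, zero_smul]
    | hadd b c hb hc => rw [map_add, LinearMap.add_apply, hb, hc, map_add, add_smul]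
    | hmul b c hb hc =>
      rw [map_mul, Module.End.mul_apply, hc, map_smul, hb, Bialgebra.counit_mul, smul_smul,
        mul_comm]

/-- In an inner faithful action on an algebra generated by a set, `x` does not kill this set. -/
theorem exists_act_x_ne_zero (hif : α.InnerFaithful) {s : Set A}
    (hs : Algebra.adjoin k s = ⊤) : ∃ a ∈ s, α.act (x hn hlam) a ≠ 0 := by
  by_contra! h0
  have hx : α.act (x hn hlam) = 0 := by
    ext a
    have ha : a ∈ Algebra.adjoin k s := by rw [hs]; trivial
    induction ha using Algebra.adjoin_induction with
    | mem a ha => exact h0 a ha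
    | algebraMap r => rw [Algebra.algebraMap_eq_smul_one, map_smul, act_x_one]; simp
    | add a b _ _ ha hb => rw [map_add, ha, hb]; simp
    | mul a b _ _ ha hb => rw [act_x_mul, ha, hb]; simp
  have h1 : α.act = α.act.comp proj := algHom_ext (by simp) (by simp [hx])
  have h2 := hif (RingHom.ker (proj (hn := hn) (hlam := hlam))) inferInstance
    isHopfIdeal_ker_proj fun h hh a => by
      rw [h1, AlgHom.comp_apply, RingHom.mem_ker.1 hh, map_zero, LinearMap.zero_apply]
  have h3 : x hn hlam ∈ RingHom.ker (proj (hn := hn) (hlam := hlam)) := RingHom.mem_ker.2 proj_x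
  rw [h2] at h3
  exact x_ne_zero h3

/-- The algebra automorphism `g ↦ λ g`, `x ↦ x`. -/
def twist : Taft hn hlam →ₐ[k] Taft hn hlam :=
  lift hn hlam (lam • g hn hlam) (x hn hlam)
    (by rw [smul_pow, hlam.pow_eq_one, g_pow, one_smul]) (x_pow hn hlam)
    (by rw [mul_smul_comm, x_mul_g, smul_mul_assoc])

@[simp] theorem twist_g : twist (g hn hlam) = lam • g hn hlam := by simp [twist]

@[simp] theorem twist_x : twist (x hn hlam) = x hn hlam := by simp [twist]

theorem isCompatible_twist : α.IsCompatible (α.act.comp twist) := by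
  let β := α.act.comp twist
  -- the action of `h₁ ⊗ h₂` on `A ⊗ A`, through `α` and `β`
  let F : Taft hn hlam →ₐ[k] Module.End k (A ⊗[k] A) :=
    ((Module.endTensorEndAlgHom (R := k) (S := k) (A := k) (M := A) (N := A)).comp
      (Algebra.TensorProduct.map α.act β)).comp (comulHom hn hlam)
  have hE : ∀ (f f' : Module.End k A) (a b : A), Module.endTensorEndAlgHom (R := k) (S := k)
      (A := k) (f ⊗ₜ[k] f') (a ⊗ₜ[k] b) = f a ⊗ₜ f' b := fun _ _ _ _ => rfl
  have key : ∀ h : Taft hn hlam,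
      (β h).comp (LinearMap.mul' k A) = (LinearMap.mul' k A).comp (F h) := by
    intro h
    induction h using Taft.induction with
    | hc c =>
      rw [AlgHom.commutes, AlgHom.commutes]
      ext a b
      simp [Module.algebraMap_end_apply]
    | hg =>
      ext a b
      simp [F, β, act_g_mul, hE]
    | hx =>
      ext a b
      simp [F, β, act_x_mul, hE]
    | hadd b c hb hc => rw [map_add, LinearMap.add_comp, hb, hc, map_add, LinearMap.comp_add]
    | hmul b c hb hc =>
      rw [map_mul, Module.End.mul_eq_comp, LinearMap.comp_assoc, hc, ← LinearMap.comp_assoc, hb,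
        LinearMap.comp_assoc, map_mul, Module.End.mul_eq_comp]
  intro h a b
  refine (LinearMap.congr_fun (key h) (a ⊗ₜ b)).trans ?_
  rw [LinearMap.comp_apply]
  congr 1
  change (F h) (a ⊗ₜ b) = TensorProduct.map _ _ (comulHom hn hlam h)
  simp only [F, AlgHom.comp_apply]
  generalize comulHom hn hlam h = t
  induction t using TensorProduct.induction_on with
  | zero => simp
  | add s t hs ht => simp only [map_add, LinearMap.add_apply, hs, ht]
  | tmul c d => simp [β, hE]

theorem span_monomials : Submodule.span k
    (Set.range fun p : Fin n × Fin n => g hn hlam ^ (p.1 : ℕ) * x hn hlam ^ (p.2 : ℕ)) = ⊤ := by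
  set S := Submodule.span k
    (Set.range fun p : Fin n × Fin n => g hn hlam ^ (p.1 : ℕ) * x hn hlam ^ (p.2 : ℕ)) with hS
  have hmem : ∀ i j : ℕ, g hn hlam ^ i * x hn hlam ^ j ∈ S := by
    intro i j
    rcases lt_or_ge j n with hj | hj
    · refine Submodule.subset_span ⟨(⟨i % n, Nat.mod_lt _ (by omega)⟩, ⟨j, hj⟩), ?_⟩
      simp only
      congr 1
      conv_rhs => rw [← Nat.mod_add_div i n, pow_add, pow_mul, g_pow, one_pow, mul_one]
    · rw [pow_eq_zero_of_le hj (x_pow hn hlam), mul_zero]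
      exact S.zero_mem
  have key : ∀ a s : Taft hn hlam, s ∈ S → a * s ∈ S := by
    intro a
    induction a using Taft.induction with
    | hc c => intro s hs; rw [← Algebra.smul_def]; exact S.smul_mem c hs
    | hg =>
      intro s hs
      induction hs using Submodule.span_induction with
      | mem s hs =>
        obtain ⟨⟨i, j⟩, rfl⟩ := hs
        rw [← mul_assoc, ← pow_succ']
        exact hmem _ _
      | zero => simp
      | add a b _ _ ha hb => rw [mul_add]; exact S.add_mem ha hb
      | smul c a _ ha => rw [mul_smul_comm]; exact S.smul_mem c ha
    | hx =>
      intro s hs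
      induction hs using Submodule.span_induction with
      | mem s hs =>
        obtain ⟨⟨i, j⟩, rfl⟩ := hs
        rw [← mul_assoc, x_mul_g_pow, smul_mul_assoc, mul_assoc, ← pow_succ']
        exact S.smul_mem _ (hmem _ _)
      | zero => simp
      | add a b _ _ ha hb => rw [mul_add]; exact S.add_mem ha hb
      | smul c a _ ha => rw [mul_smul_comm]; exact S.smul_mem c ha
    | hadd b c hb hc => intro s hs; rw [add_mul]; exact S.add_mem (hb s hs) (hc s hs)
    | hmul b c hb hc => intro s hs; rw [mul_assoc]; exact hb _ (hc s hs)
  refine eq_top_iff.2 fun a _ => ?_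
  simpa using key a 1 (by simpa using hmem 0 0)

theorem exists_eq_sum_mk (r : α.SmashProduct) : ∃ a : Fin n × Fin n → A,
    r = ∑ p, HopfAction.SmashProduct.mk α (a p)
      (g hn hlam ^ (p.1 : ℕ) * x hn hlam ^ (p.2 : ℕ)) := by
  induction r using HopfAction.SmashProduct.induction with
  | h0 => exact ⟨0, by simp [HopfAction.SmashProduct.mk_zero_left]⟩
  | hadd r s hr hs =>
    obtain ⟨a, rfl⟩ := hr
    obtain ⟨b, rfl⟩ := hs
    exact ⟨a + b, by simp [HopfAction.SmashProduct.mk_add_left, Finset.sum_add_distrib]⟩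
  | hmk a h =>
    have hh : h ∈ Submodule.span k (Set.range fun p : Fin n × Fin n =>
      g hn hlam ^ (p.1 : ℕ) * x hn hlam ^ (p.2 : ℕ)) := by rw [span_monomials]; trivial
    obtain ⟨c, rfl⟩ := (Submodule.mem_span_range_iff_exists_fun k).1 hh
    refine ⟨fun p => c p • a, ?_⟩
    rw [HopfAction.SmashProduct.mk_sum_right]
    simp only [HopfAction.SmashProduct.mk_smul_right]

/-- The left integral `(∑ g ^ i) x ^ (n - 1)` of `H_n(λ)`. -/
def integral : Taft hn hlam :=
  (∑ i ∈ Finset.range n, g hn hlam ^ i) * x hn hlam ^ (n - 1)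

theorem mul_integral (h : Taft hn hlam) :
    h * integral = counit (R := k) h • (integral : Taft hn hlam) := by
  induction h using Taft.induction with
  | hc c => rw [Bialgebra.counit_algebraMap, ← Algebra.smul_def]
  | hg =>
    have := mul_geom_sum (g hn hlam) n
    rw [g_pow, sub_self, sub_mul, one_mul, sub_eq_zero] at this
    rw [counit_g, one_smul, integral, ← mul_assoc, this]
  | hx =>
    rw [counit_x, zero_smul, integral, ← mul_assoc, Finset.mul_sum, Finset.sum_mul]
    refine Finset.sum_eq_zero fun i _ => ?_
    rw [x_mul_g_pow, smul_mul_assoc, mul_assoc, ← pow_succ', Nat.sub_add_cancel hn.le, x_pow,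
      mul_zero, smul_zero]
  | hadd b c hb hc => rw [add_mul, hb, hc, map_add, add_smul]
  | hmul b c hb hc => rw [mul_assoc, hc, mul_smul_comm, hb, Bialgebra.counit_mul, smul_smul,
      mul_comm]

end Taft

/-! ### Classification of the linear actions -/

section Classification

variable {k : Type*} [Field k] {n : ℕ} {lam : k} {hn : 1 < n} {hlam : IsPrimitiveRoot lam n}
  {A : Type*} [Ring A] [Algebra k A]

/-- The normal form of a linear action of `H_n(λ)` on the algebra generated by a quantum pair:
`g` is diagonal with eigenvalues `μ` and `λ μ`, and `x` maps `v` to `c u` and `u` to `0`. The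
field `weyl` says that `g` preserves the constant term of the relation. -/
structure IsTriangularAction (α : HopfAction k (Taft hn hlam) A) (mu κ c : k) (u v : A) :
    Prop where
  pair : IsQuantumPair mu κ u v
  g_u : α.act (Taft.g hn hlam) u = mu • u
  g_v : α.act (Taft.g hn hlam) v = (lam * mu) • v
  x_u : α.act (Taft.x hn hlam) u = 0
  x_v : α.act (Taft.x hn hlam) v = c • u
  c_ne_zero : c ≠ 0
  weyl : lam * mu ^ 2 * κ = κ

variable (α : HopfAction k (Taft hn hlam) A) {mu κ : k} {u v : A}

/-- Up to exchanging `u` and `v`, every linear action of `H_n(λ)` with `x` acting nontrivially is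
triangular. The relation forces `g` to be diagonal or antidiagonal. In the antidiagonal case
`μ = λ = -1`, hence `n = 2`, and `g ^ 2 = 1` contradicts the relation between `x` and `u v + v u`.
In the diagonal case `x` sends each generator to a multiple of the other one, and it is
nilpotent. -/
theorem exists_isTriangularAction (h : IsQuantumPair mu κ u v) (h0 : mu ≠ 0) (h1 : mu ≠ 1)
    (hlin : ∀ t ∈ ({Taft.g hn hlam, Taft.x hn hlam} : Set (Taft hn hlam)), ∀ w ∈ ({u, v} : Set A),
      α.act t w ∈ Submodule.span k {u, v})
    (hx : ∃ w ∈ ({u, v} : Set A), α.act (Taft.x hn hlam) w ≠ 0) :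
    (∃ c, IsTriangularAction α mu κ c u v) ∨
      ∃ c, IsTriangularAction α mu⁻¹ (-mu⁻¹ * κ) c v u := by
  have hl1 : lam ≠ 1 := hlam.ne_one hn
  have hsw := h.swap h0
  have hlin' := fun t ht w hw => Submodule.mem_span_pair.1 (hlin t ht w hw)
  obtain ⟨a, b, hgu⟩ := hlin' (Taft.g hn hlam) (by simp) u (by simp)
  obtain ⟨c, d, hgv⟩ := hlin' (Taft.g hn hlam) (by simp) v (by simp)
  obtain ⟨p, q, hxu⟩ := hlin' (Taft.x hn hlam) (by simp) u (by simp)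
  obtain ⟨r, s, hxv⟩ := hlin' (Taft.x hn hlam) (by simp) v (by simp)
  have hu0 : u ≠ 0 := by simpa using h.indep.ne_zero (1, 0)
  have hv0 : v ≠ 0 := by simpa using h.indep.ne_zero (0, 1)
  have hrel := h.rel
  -- `g` preserves the defining relation
  obtain ⟨gvv, gvu, guu, -, -, g1⟩ := hsw.coeff_eq_zero (a := b * d * (1 - mu))
      (b := b * c * (1 - mu ^ 2)) (c := a * c * (1 - mu)) (d := 0) (e := 0)
      (f := κ * (a * d - mu * c * b) - κ) (by
    have e := congrArg (α.act (Taft.g hn hlam)) hrel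
    rw [map_add, map_smul, map_smul, Taft.act_g_mul, Taft.act_g_mul, Taft.act_g_one, ← hgu,
      ← hgv] at e
    simp only [add_mul, mul_add, smul_mul_smul_comm, hrel] at e
    linear_combination (norm := module) e)
  -- `x` preserves the defining relation
  obtain ⟨xvv, xvu, xuu, -, -, -⟩ := hsw.coeff_eq_zero (a := b * s + q - mu * d * q)
      (b := mu * (a * s + p - mu * c * q) + b * r - mu * d * p - mu * s)
      (c := a * r - mu * (c * p + r)) (d := 0) (e := 0)
      (f := κ * (a * s + p - mu * c * q)) (by
    have e := congrArg (α.act (Taft.x hn hlam)) hrel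
    rw [map_add, map_smul, map_smul, Taft.act_x_mul, Taft.act_x_mul, Taft.act_x_one, ← hgu,
      ← hgv, ← hxu, ← hxv] at e
    simp only [add_mul, mul_add, smul_mul_assoc, mul_smul_comm, hrel] at e
    linear_combination (norm := module) e)
  -- `x g = λ g x` on `u` and on `v`
  obtain ⟨-, -, -, cuu, cuv, -⟩ := h.coeff_eq_zero (a := 0) (b := 0) (c := 0)
      (d := a * p + b * r - lam * (p * a + q * c)) (e := a * q + b * s - lam * (p * b + q * d))
      (f := 0) (by
    have e := Taft.act_x_act_g α u
    simp only [← hgu, ← hxu, map_add, map_smul, ← hgv, ← hxv] at e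
    linear_combination (norm := module) e)
  obtain ⟨-, -, -, cvu, cvv, -⟩ := h.coeff_eq_zero (a := 0) (b := 0) (c := 0)
      (d := c * p + d * r - lam * (r * a + s * c)) (e := c * q + d * s - lam * (r * b + s * d))
      (f := 0) (by
    have e := Taft.act_x_act_g α v
    simp only [← hgv, ← hxv, map_add, map_smul, ← hgu, ← hxu] at e
    linear_combination (norm := module) e)
  have hnz : p ≠ 0 ∨ q ≠ 0 ∨ r ≠ 0 ∨ s ≠ 0 := by
    by_contra! hz
    obtain ⟨rfl, rfl, rfl, rfl⟩ := hz
    obtain ⟨w, rfl | rfl, hw⟩ := hx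
    · exact hw (by rw [← hxu]; simp)
    · exact hw (by rw [← hxv]; simp)
  have h1' : 1 - mu ≠ 0 := sub_ne_zero.2 h1.symm
  have hac : a * c = 0 := (mul_eq_zero.1 guu).resolve_right h1'
  have hbd : b * d = 0 := (mul_eq_zero.1 gvv).resolve_right h1'
  have hab : ¬(a = 0 ∧ b = 0) := fun hz =>
    hu0 (Taft.act_g_injective α (by rw [← hgu, hz.1, hz.2]; simp))
  have hcd : ¬(c = 0 ∧ d = 0) := fun hz =>
    hv0 (Taft.act_g_injective α (by rw [← hgv, hz.1, hz.2]; simp))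
  by_cases ha : a = 0
  · -- the antidiagonal case
    exfalso
    have hb : b ≠ 0 := fun hb => hab ⟨ha, hb⟩
    have hd : d = 0 := (mul_eq_zero.1 hbd).resolve_left hb
    have hc : c ≠ 0 := fun hc => hcd ⟨hc, hd⟩
    subst ha hd
    have hmu : mu = -1 := by
      have : (1 - mu) * (1 + mu) = 0 := by
        refine (mul_eq_zero.1 ?_).resolve_left (mul_ne_zero hb hc)
        linear_combination gvu
      linear_combination (mul_eq_zero.1 this).resolve_left h1'
    subst hmu
    have h2 : (2 : k) ≠ 0 := fun h2 => h1 (by linear_combination -h2)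
    have hr : r = -(c * p) := by linear_combination xuu
    have hq : q = -(b * s) := by linear_combination xvv
    have hs : s = lam * p := mul_left_cancel₀ hb (by linear_combination cuv)
    have hp : p = lam * s := mul_left_cancel₀ hc (by linear_combination cvu)
    have hp0 : p ≠ 0 := by
      intro hp0
      rw [hp0, mul_zero] at hs
      rw [hp0, mul_zero, neg_zero] at hr
      rw [hs, mul_zero, neg_zero] at hq
      tauto
    have hl : lam ^ 2 = 1 := mul_right_cancel₀ hp0 (by rw [hs] at hp; linear_combination -hp)
    have hl2 : lam = -1 := by
      have : (lam - 1) * (lam + 1) = 0 := by linear_combination hl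
      linear_combination (mul_eq_zero.1 this).resolve_left (sub_ne_zero.2 hl1)
    have hn2 : n = 2 := by
      have := Nat.le_of_dvd two_pos (hlam.dvd_of_pow_eq_one 2 hl)
      omega
    have hbc : b * c = 1 := by
      have e := Taft.act_g_iterate α u
      rw [congrArg (α.act (Taft.g hn hlam) ^ ·) hn2, pow_two, Module.End.mul_apply, ← hgu,
        zero_smul, zero_add, map_smul, ← hgv, zero_smul, add_zero, smul_smul] at e
      have := smul_left_injective k hu0 (e.trans (one_smul k u).symm)
      exact this
    have : p * (2 * 2) = 0 := by
      rw [hr, hq, hs, hl2] at xvu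
      linear_combination -xvu - 2 * p * hbc
    exact (mul_ne_zero hp0 (mul_ne_zero h2 h2)) this
  · -- the diagonal case
    have hc : c = 0 := (mul_eq_zero.1 hac).resolve_left ha
    have hd : d ≠ 0 := fun hd => hcd ⟨hc, hd⟩
    have hb : b = 0 := (mul_eq_zero.1 hbd).resolve_right hd
    subst hb hc
    have hl1' : 1 - lam ≠ 0 := sub_ne_zero.2 hl1.symm
    have hp : p = 0 := by
      refine (mul_eq_zero.1 (?_ : (a * (1 - lam)) * p = 0)).resolve_left (mul_ne_zero ha hl1')
      linear_combination cuu
    have hs : s = 0 := by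
      refine (mul_eq_zero.1 (?_ : (d * (1 - lam)) * s = 0)).resolve_left (mul_ne_zero hd hl1')
      linear_combination cvv
    subst hp hs
    simp only [zero_smul, zero_add, add_zero] at hgu hgv hxu hxv
    -- `x ^ 2` multiplies `u` by `q r`, and `x` is nilpotent
    have hqr : q * r = 0 := by
      have e : ∀ j : ℕ, ((α.act (Taft.x hn hlam)) ^ (2 * j)) u = (q * r) ^ j • u := by
        intro j
        induction j with
        | zero => simp
        | succ j ih =>
          rw [mul_add, mul_one, pow_add, Module.End.mul_apply, pow_two, Module.End.mul_apply,
            ← hxu, map_smul, ← hxv, map_smul, map_smul, ih, smul_smul, smul_smul, pow_succ]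
          congr 1; ring
      have e2 := e n
      rw [mul_comm, pow_mul, pow_two, Module.End.mul_apply, Taft.act_x_iterate] at e2
      exact eq_zero_of_pow_eq_zero ((smul_eq_zero.1 e2.symm).resolve_right hu0)
    by_cases hr : r = 0
    · right
      have hq : q ≠ 0 := by tauto
      have hd' : d = mu⁻¹ := by
        refine eq_inv_of_mul_eq_one_right (mul_right_cancel₀ hq ?_)
        linear_combination -xvv
      have ha' : a = lam * mu⁻¹ := by
        rw [← hd']
        exact mul_right_cancel₀ hq (by linear_combination cuv)
      refine ⟨q, hsw, by rw [← hgv, hd'], by rw [← hgu, ha'], by rw [← hxv, hr, zero_smul],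
        hxu.symm, hq, ?_⟩
      rw [hd', ha'] at g1
      linear_combination (-mu⁻¹) * g1
    · left
      have ha' : a = mu := mul_right_cancel₀ hr (by linear_combination xuu)
      have hd' : d = lam * mu := by
        rw [← ha']
        exact mul_right_cancel₀ hr (by linear_combination cvu)
      have hq : q = 0 := (mul_eq_zero.1 hqr).resolve_right hr
      refine ⟨r, h, by rw [← hgu, ha'], by rw [← hgv, hd'], by rw [← hxu, hq, zero_smul],
        hxv.symm, hr, ?_⟩
      rw [hd', ha'] at g1
      linear_combination g1

end Classification

/-! ### Ordered polynomials -/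

section NormalEval

open MvPolynomial

variable {k : Type*} [Field k] {A : Type*} [Ring A] [Algebra k A]

/-- Evaluation of ordered polynomials: the linear map which sends the monomial `X₀ ^ i X₁ ^ j` to
`a ^ i b ^ j`. It is multiplicative only if `a` and `b` commute. -/
def normalEval (a b : A) : MvPolynomial (Fin 2) k →ₗ[k] A :=
  (basisMonomials (Fin 2) k).constr k fun s => a ^ s 0 * b ^ s 1

theorem normalEval_monomial (a b : A) (s : Fin 2 →₀ ℕ) :
    normalEval (k := k) a b (monomial s 1) = a ^ s 0 * b ^ s 1 := by
  have := (basisMonomials (Fin 2) k).constr_basis k (fun s => a ^ s 0 * b ^ s 1) s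
  rwa [coe_basisMonomials] at this

theorem normalEval_X_pow_mul_X_pow (a b : A) (i j : ℕ) :
    normalEval (k := k) a b (X 0 ^ i * X 1 ^ j) = a ^ i * b ^ j := by
  have h : (X 0 ^ i * X 1 ^ j : MvPolynomial (Fin 2) k) =
      monomial (Finsupp.single 0 i + Finsupp.single 1 j) 1 := by
    rw [X_pow_eq_monomial, X_pow_eq_monomial, monomial_mul, one_mul]
  rw [h, normalEval_monomial]
  simp

theorem normalEval_one (a b : A) : normalEval (k := k) a b 1 = 1 := by
  simpa using normalEval_X_pow_mul_X_pow (k := k) a b 0 0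

theorem normalEval_X_zero (a b : A) : normalEval (k := k) a b (X 0) = a := by
  simpa using normalEval_X_pow_mul_X_pow (k := k) a b 1 0

theorem normalEval_X_one (a b : A) : normalEval (k := k) a b (X 1) = b := by
  simpa using normalEval_X_pow_mul_X_pow (k := k) a b 0 1

theorem normalEval_injective {a b : A}
    (h : LinearIndependent k fun p : ℕ × ℕ => a ^ p.1 * b ^ p.2) :
    Function.Injective (normalEval (k := k) a b) := by
  have hinj : Function.Injective fun s : Fin 2 →₀ ℕ => (s 0, s 1) := by
    intro s t hst
    have hst' : s 0 = t 0 ∧ s 1 = t 1 := Prod.ext_iff.1 hst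
    ext i
    fin_cases i
    exacts [hst'.1, hst'.2]
  have h1 := h.comp _ hinj
  have h2 : ∀ P, normalEval (k := k) a b P =
      Finsupp.linearCombination k
        ((fun p : ℕ × ℕ => a ^ p.1 * b ^ p.2) ∘ fun s : Fin 2 →₀ ℕ => (s 0, s 1))
        ((basisMonomials (Fin 2) k).repr P) := fun P =>
    (Module.Basis.constr_apply _ _ _ _).trans (Finsupp.linearCombination_apply _ _).symm
  intro P Q hPQ
  rw [h2, h2] at hPQ
  exact (basisMonomials (Fin 2) k).repr.injective (h1 hPQ)

theorem ordered_monomial_induction {C : MvPolynomial (Fin 2) k → Prop}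
    (hmon : ∀ i j : ℕ, C (X 0 ^ i * X 1 ^ j)) (hadd : ∀ P Q, C P → C Q → C (P + Q))
    (hsmul : ∀ (c : k) P, C P → C (c • P)) (P : MvPolynomial (Fin 2) k) : C P := by
  induction P using MvPolynomial.induction_on' with
  | monomial s c =>
    have : (monomial s c : MvPolynomial (Fin 2) k) = c • (X 0 ^ s 0 * X 1 ^ s 1) := by
      rw [monomial_eq, Finsupp.prod_fintype _ _ (fun _ => pow_zero _), Fin.prod_univ_two,
        smul_eq_C_mul]
    rw [this]
    exact hsmul _ _ (hmon _ _)
  | add P Q hP hQ => exact hadd P Q hP hQ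

theorem normalEval_surjective {a b : A}
    (h : ⊤ ≤ Submodule.span k (Set.range fun p : ℕ × ℕ => a ^ p.1 * b ^ p.2)) :
    Function.Surjective (normalEval (k := k) a b) := by
  rw [← LinearMap.range_eq_top, eq_top_iff]
  refine h.trans (Submodule.span_le.2 ?_)
  rintro _ ⟨⟨i, j⟩, rfl⟩
  exact ⟨X 0 ^ i * X 1 ^ j, normalEval_X_pow_mul_X_pow a b i j⟩

/-- Multiplying from the left by an ordered polynomial in `u ^ m` and `v ^ l` is multiplication of
commutative polynomials, if `u` commutes with `v ^ l`. -/
theorem normalEval_mul {u v : A} {m l : ℕ} (h : Commute u (v ^ l))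
    (f P : MvPolynomial (Fin 2) k) :
    normalEval u v (aeval ![X 0 ^ m, X 1 ^ l] f * P) =
      normalEval (u ^ m) (v ^ l) f * normalEval u v P := by
  induction f using ordered_monomial_induction with
  | hadd f g hf hg => rw [map_add, add_mul, map_add, hf, hg, map_add, add_mul]
  | hsmul c f hf => rw [map_smul, smul_mul_assoc, map_smul, hf, map_smul, smul_mul_assoc]
  | hmon i j =>
    induction P using ordered_monomial_induction with
    | hadd P Q hP hQ => rw [mul_add, map_add, hP, hQ, map_add, mul_add]
    | hsmul c P hP => rw [mul_smul_comm, map_smul, hP, map_smul, mul_smul_comm]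
    | hmon p q =>
      have h1 : aeval ![X 0 ^ m, X 1 ^ l] (X 0 ^ i * X 1 ^ j : MvPolynomial (Fin 2) k) *
          (X 0 ^ p * X 1 ^ q) = (X 0 ^ (m * i + p) * X 1 ^ (l * j + q) :
            MvPolynomial (Fin 2) k) := by
        simp
        ring
      rw [h1, normalEval_X_pow_mul_X_pow, normalEval_X_pow_mul_X_pow, normalEval_X_pow_mul_X_pow,
        pow_add, pow_add, pow_mul, pow_mul, mul_assoc, mul_assoc, ← mul_assoc (u ^ p),
        ((h.pow_pow p j)).eq]
      simp only [mul_assoc]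

/-- Left multiplication by a nonzero ordered polynomial in `u ^ m` and `v ^ l` is injective. -/
theorem normalEval_mul_cancel {u v : A} {m l : ℕ} (h : Commute u (v ^ l))
    (hind : LinearIndependent k fun p : ℕ × ℕ => u ^ p.1 * v ^ p.2)
    (hspan : ⊤ ≤ Submodule.span k (Set.range fun p : ℕ × ℕ => u ^ p.1 * v ^ p.2))
    {f : MvPolynomial (Fin 2) k} (hf : normalEval (u ^ m) (v ^ l) f ≠ 0) {q : A}
    (hq : normalEval (u ^ m) (v ^ l) f * q = 0) : q = 0 := by
  obtain ⟨Q, rfl⟩ := normalEval_surjective hspan q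
  rw [← normalEval_mul h, map_eq_zero_iff _ (normalEval_injective hind), mul_eq_zero] at hq
  rcases hq with hq | rfl
  · have := normalEval_mul (m := m) h f 1
    rw [hq, zero_mul, map_zero, normalEval_one, mul_one] at this
    exact absurd this.symm hf
  · rw [map_zero]

/-- The evaluation of polynomials at a pair of commuting elements. -/
def commEval {a b : A} (h : Commute a b) : MvPolynomial (Fin 2) k →ₐ[k] A :=
  AlgHom.ofLinearMap (normalEval a b) (normalEval_one a b) fun f g => by
    have h1 := normalEval_mul (k := k) (m := 1) (l := 1) (by simpa using h) f g
    have h2 : (![X 0 ^ 1, X 1 ^ 1] : Fin 2 → MvPolynomial (Fin 2) k) = X := by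
      ext1 i
      fin_cases i <;> simp
    rwa [h2, aeval_X_left, AlgHom.id_apply, pow_one, pow_one] at h1

theorem range_commEval {a b : A} (h : Commute a b) :
    (commEval (k := k) h).range = Algebra.adjoin k {a, b} := by
  have h0 : commEval (k := k) h (X 0) = a := normalEval_X_zero a b
  have h1 : commEval (k := k) h (X 1) = b := normalEval_X_one a b
  rw [← Algebra.map_top, ← adjoin_range_X, AlgHom.map_adjoin]
  congr 1
  ext z
  constructor
  · rintro ⟨_, ⟨i, rfl⟩, rfl⟩
    fin_cases i
    · exact Or.inl h0
    · exact Or.inr h1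
  · rintro (rfl | rfl)
    · exact ⟨_, ⟨0, rfl⟩, h0⟩
    · exact ⟨_, ⟨1, rfl⟩, h1⟩

theorem isPolynomialRingIn_of_indep {S : Subalgebra k A} {a b : A} (h : Commute a b)
    (hind : LinearIndependent k fun p : ℕ × ℕ => a ^ p.1 * b ^ p.2)
    (hS : S = Algebra.adjoin k {a, b}) : IsPolynomialRingIn S a b := by
  refine ⟨hS, ?_⟩
  rw [← range_commEval h] at hS
  subst hS
  exact ⟨AlgEquiv.ofInjective (commEval h) (normalEval_injective hind), normalEval_X_zero a b,
    normalEval_X_one a b⟩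

theorem IsPolynomialRingIn.swap {S : Subalgebra k A} {a b : A}
    (h : IsPolynomialRingIn S a b) : IsPolynomialRingIn S b a := by
  obtain ⟨h1, e, h2, h3⟩ := h
  refine ⟨by rw [h1, Set.pair_comm], (renameEquiv k (Equiv.swap 0 1)).trans e, ?_, ?_⟩
  · simpa using h3
  · simpa using h2

end NormalEval

/-! ### The fixed ring of a triangular action -/

section Triangular

variable {k : Type*} [Field k]

/-- The coefficients of `v ^ (j - 2)` in `x · v ^ j`. They vanish if `κ = 0`. -/
def defect (lam mu κ c : k) : ℕ → k
  | 0 => 0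
  | j + 1 => lam * mu * defect lam mu κ c j - lam * κ * (c * ∑ l ∈ Finset.range j, lam ^ l)

theorem defect_of_kappa_eq_zero (lam mu c : k) (j : ℕ) : defect lam mu 0 c j = 0 := by
  induction j with
  | zero => rfl
  | succ j ih => rw [defect, ih]; ring

theorem geom_sum_ne_zero {n : ℕ} {lam : k} (hlam : IsPrimitiveRoot lam n) {j : ℕ} (hj : ¬ n ∣ j) :
    ∑ l ∈ Finset.range j, lam ^ l ≠ 0 := by
  intro h
  have := mul_geom_sum lam j
  rw [h, mul_zero] at this
  exact hj (hlam.dvd_of_pow_eq_one j (sub_eq_zero.1 this.symm))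

namespace IsTriangularAction

variable {n : ℕ} {lam : k} {hn : 1 < n} {hlam : IsPrimitiveRoot lam n}
  {A : Type*} [Ring A] [Algebra k A] {α : HopfAction k (Taft hn hlam) A} {mu κ c : k} {u v : A}

section

variable (T : IsTriangularAction α mu κ c u v)
include T

theorem mu_pow : mu ^ n = 1 := by
  have h : ∀ j : ℕ, (α.act (Taft.g hn hlam) ^ j) u = mu ^ j • u := by
    intro j
    induction j with
    | zero => simp
    | succ j ih => rw [pow_succ, Module.End.mul_apply, T.g_u, map_smul, ih, smul_smul, pow_succ']
  have h2 := h n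
  rw [Taft.act_g_iterate] at h2
  have hu0 : u ≠ 0 := by simpa using T.pair.indep.ne_zero (1, 0)
  exact smul_left_injective k hu0 (h2.symm.trans (one_smul k u).symm)

theorem mu_ne_zero : mu ≠ 0 := fun h => by
  have := T.mu_pow
  rw [h, zero_pow (by omega)] at this
  exact zero_ne_one this

theorem act_g_u_pow (i : ℕ) : α.act (Taft.g hn hlam) (u ^ i) = mu ^ i • u ^ i := by
  rw [Taft.act_g_pow, T.g_u, smul_pow]

theorem act_g_monomial (i j : ℕ) : α.act (Taft.g hn hlam) (u ^ i * v ^ j) =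
    (mu ^ i * (lam * mu) ^ j) • (u ^ i * v ^ j) := by
  rw [Taft.act_g_mul, T.act_g_u_pow, Taft.act_g_pow, T.g_v, smul_pow, smul_mul_smul_comm]

theorem act_x_u_mul (a : A) :
    α.act (Taft.x hn hlam) (u * a) = mu • (u * α.act (Taft.x hn hlam) a) := by
  rw [Taft.act_x_mul, T.g_u, T.x_u, zero_mul, add_zero, smul_mul_assoc]

theorem act_x_u_pow_mul (i : ℕ) (a : A) :
    α.act (Taft.x hn hlam) (u ^ i * a) = mu ^ i • (u ^ i * α.act (Taft.x hn hlam) a) := by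
  induction i with
  | zero => simp
  | succ i ih =>
    rw [pow_succ', mul_assoc, T.act_x_u_mul, ih, mul_smul_comm, smul_smul, pow_succ', mul_assoc]

theorem act_x_v_mul (a : A) : α.act (Taft.x hn hlam) (v * a) =
    (lam * mu) • (v * α.act (Taft.x hn hlam) a) + c • (u * a) := by
  rw [Taft.act_x_mul, T.g_v, T.x_v, smul_mul_assoc, smul_mul_assoc]

theorem act_x_v_pow (j : ℕ) : α.act (Taft.x hn hlam) (v ^ (j + 2)) =
    (c * ∑ l ∈ Finset.range (j + 2), lam ^ l) • (u * v ^ (j + 1)) +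
      defect lam mu κ c (j + 2) • v ^ j := by
  have h0 := T.mu_ne_zero
  have hvu : ∀ (e : k) (a : A), (lam * mu) • (v * (e • (u * a))) =
      (lam * e) • (u * (v * a)) - (lam * κ * e) • a := by
    intro e a
    rw [mul_smul_comm, ← mul_assoc, T.pair.v_mul_u h0, sub_mul, smul_mul_assoc, smul_mul_assoc,
      one_mul, mul_assoc, smul_smul, smul_sub, smul_smul, smul_smul]
    congr 2 <;> field_simp
  induction j with
  | zero =>
    have h := hvu c 1
    rw [mul_one] at h
    rw [zero_add, pow_two, T.act_x_v_mul, T.x_v, h]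
    simp only [defect, Finset.sum_range_succ, Finset.sum_range_zero]
    simp only [pow_zero, pow_one, mul_one, zero_add]
    module
  | succ j ih =>
    have hs : ∑ l ∈ Finset.range (j + 1 + 2), lam ^ l =
        lam * ∑ l ∈ Finset.range (j + 2), lam ^ l + 1 := geom_sum_succ
    have hd : defect lam mu κ c (j + 1 + 2) = lam * mu * defect lam mu κ c (j + 2) -
        lam * κ * (c * ∑ l ∈ Finset.range (j + 2), lam ^ l) := rfl
    rw [pow_succ' v, T.act_x_v_mul, ih, mul_add, smul_add, hvu, ← pow_succ', mul_smul_comm,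
      ← pow_succ', hs, hd]
    module

/-- If `n ∣ j` then `v ^ j` commutes with `u` and `v`, so that `D = x · v ^ j` satisfies
`D v = λ μ v D`. As `D` is a multiple of `v ^ (j - 2)`, either `D = 0` or `λ μ = 1`, and in the
latter case `κ = 0`. -/
theorem defect_eq_zero (h1 : mu ≠ 1) {j : ℕ} (hj : n ∣ j + 2) : defect lam mu κ c (j + 2) = 0 := by
  have hmuj : mu ^ (j + 2) = 1 := by
    obtain ⟨d, hd⟩ := hj
    rw [hd, pow_mul, T.mu_pow, one_pow]
  have hlamj : lam ^ (j + 2) = 1 := (hlam.pow_eq_one_iff_dvd _).2 hj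
  have hsum := geom_sum_eq_zero (hlam.ne_one hn) hlamj
  have hx := T.act_x_v_pow j
  rw [hsum, mul_zero, zero_smul, zero_add] at hx
  have hg : α.act (Taft.g hn hlam) (v ^ (j + 2)) = v ^ (j + 2) := by
    rw [Taft.act_g_pow, T.g_v, smul_pow, mul_pow, hmuj, hlamj, one_mul, one_smul]
  have e1 := Taft.act_x_mul α (v ^ (j + 2)) v
  rw [← pow_succ, pow_succ', T.act_x_v_mul, hg, T.x_v, hx, mul_smul_comm _ v, mul_smul_comm c,
    ← (T.pair.commute_v_pow h1 hmuj).eq, smul_mul_assoc, ← pow_succ, ← pow_succ', add_comm,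
    add_right_inj, smul_smul] at e1
  have hv0 : v ^ (j + 1) ≠ 0 := by simpa using T.pair.indep.ne_zero (0, j + 1)
  have e2 : lam * mu * defect lam mu κ c (j + 2) = defect lam mu κ c (j + 2) :=
    smul_left_injective k hv0 e1
  by_cases hlm : lam * mu = 1
  · have hκ : κ = 0 := by
      have h3 := T.weyl
      have : (mu - 1) * κ = 0 := by linear_combination h3 - mu * κ * hlm
      exact (mul_eq_zero.1 this).resolve_left (sub_ne_zero.2 h1)
    rw [hκ, defect_of_kappa_eq_zero]
  · have : (lam * mu - 1) * defect lam mu κ c (j + 2) = 0 := by linear_combination e2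
    exact (mul_eq_zero.1 this).resolve_left (sub_ne_zero.2 hlm)

/-- The monomial basis. -/
abbrev basis : Module.Basis (ℕ × ℕ) k A := T.pair.basis T.mu_ne_zero

theorem basis_apply (i j : ℕ) : T.basis (i, j) = u ^ i * v ^ j := T.pair.basis_apply _ _

theorem coord_act_g (a : A) (p : ℕ × ℕ) : T.basis.coord p (α.act (Taft.g hn hlam) a) =
    mu ^ p.1 * (lam * mu) ^ p.2 * T.basis.coord p a := by
  have : (T.basis.coord p).comp (α.act (Taft.g hn hlam)) =
      (mu ^ p.1 * (lam * mu) ^ p.2) • T.basis.coord p := by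
    refine T.basis.ext fun q => ?_
    obtain ⟨i, j⟩ := q
    rw [LinearMap.comp_apply, LinearMap.smul_apply, T.basis_apply, T.act_g_monomial, map_smul,
      ← T.basis_apply, T.basis.coord_apply, T.basis.repr_self, smul_eq_mul, smul_eq_mul,
      Finsupp.single_apply]
    split_ifs with h
    · rw [← h]
    · simp
  exact LinearMap.congr_fun this a

theorem coord_act_x (a : A) (i j : ℕ) : T.basis.coord (i + 1, j) (α.act (Taft.x hn hlam) a) =
    mu ^ i * (c * ∑ l ∈ Finset.range (j + 1), lam ^ l) * T.basis.coord (i, j + 1) a +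
      mu ^ (i + 1) * defect lam mu κ c (j + 2) * T.basis.coord (i + 1, j + 2) a := by
  have : (T.basis.coord (i + 1, j)).comp (α.act (Taft.x hn hlam)) =
      (mu ^ i * (c * ∑ l ∈ Finset.range (j + 1), lam ^ l)) • T.basis.coord (i, j + 1) +
      (mu ^ (i + 1) * defect lam mu κ c (j + 2)) • T.basis.coord (i + 1, j + 2) := by
    refine T.basis.ext fun q => ?_
    obtain ⟨p, q⟩ := q
    rw [LinearMap.comp_apply, T.basis_apply, T.act_x_u_pow_mul, LinearMap.add_apply,
      LinearMap.smul_apply, LinearMap.smul_apply, ← T.basis_apply]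
    simp only [T.basis.coord_apply, T.basis.repr_self, smul_eq_mul, Finsupp.single_apply]
    rcases q with _ | _ | q
    · rw [pow_zero, Taft.act_x_one]
      simp
    · rw [pow_one, T.x_v, mul_smul_comm, ← pow_succ, show u ^ (p + 1) = u ^ (p + 1) * v ^ 0 by simp,
        ← T.basis_apply, map_smul, map_smul, T.basis.repr_self]
      by_cases hj : j = 0
      · subst hj
        by_cases hp : p = i <;> simp [hp]
      · simp [hj]
    · rw [T.act_x_v_pow, mul_add, mul_smul_comm, mul_smul_comm, ← mul_assoc, ← pow_succ,
        ← T.basis_apply, ← T.basis_apply, map_smul, map_add, map_smul, map_smul, T.basis.repr_self,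
        T.basis.repr_self]
      simp only [Finsupp.smul_apply, Finsupp.add_apply, Finsupp.single_apply, Prod.mk.injEq,
        smul_eq_mul, Nat.add_right_cancel_iff]
      by_cases e1 : p = i ∧ q + 1 = j
      · obtain ⟨rfl, rfl⟩ := e1
        simp
      · by_cases e2 : p = i + 1 ∧ q = j
        · obtain ⟨rfl, rfl⟩ := e2
          simp
        · simp [e1, e2]
  exact LinearMap.congr_fun this a

/-- The kernel of `x` is contained in the span of the `u ^ i v ^ j` with `n ∣ j`. -/
theorem coord_eq_zero_of_act_x (h1 : mu ≠ 1) {a : A} (ha : α.act (Taft.x hn hlam) a = 0)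
    (i j : ℕ) (hj : ¬ n ∣ j) : T.basis.coord (i, j) a = 0 := by
  obtain ⟨N, hN⟩ : ∃ N, ∀ i j : ℕ, N ≤ j → T.basis.coord (i, j) a = 0 := by
    refine ⟨((T.basis.repr a).support.image Prod.snd).sup id + 1, fun i j hij => ?_⟩
    by_contra hne
    have hm : j ∈ (T.basis.repr a).support.image Prod.snd :=
      Finset.mem_image.2 ⟨(i, j), Finsupp.mem_support_iff.2 hne, rfl⟩
    have := Finset.le_sup (f := id) hm
    simp only [id] at this hij
    omega
  -- descending induction on the exponent of `v`
  have key : ∀ d j : ℕ, N ≤ j + d → ∀ i, ¬ n ∣ j → T.basis.coord (i, j) a = 0 := by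
    intro d
    induction d with
    | zero => exact fun j hj i _ => hN i j hj
    | succ d ih =>
      intro j hjd i hj
      obtain ⟨j, rfl⟩ : ∃ j', j = j' + 1 := ⟨j - 1, by
        have : j ≠ 0 := fun h => hj (h ▸ dvd_zero n)
        omega⟩
      have e := T.coord_act_x a i j
      have e2 : defect lam mu κ c (j + 2) * T.basis.coord (i + 1, j + 2) a = 0 := by
        by_cases hj2 : n ∣ j + 2
        · rw [T.defect_eq_zero h1 hj2, zero_mul]
        · rw [ih (j + 2) (by omega) _ hj2, mul_zero]
      rw [ha, map_zero, mul_assoc (mu ^ (i + 1)), e2, mul_zero, add_zero] at e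
      exact (mul_eq_zero.1 e.symm).resolve_left
        (mul_ne_zero (pow_ne_zero _ T.mu_ne_zero)
          (mul_ne_zero T.c_ne_zero (geom_sum_ne_zero hlam hj)))
  exact key N j (by omega) i hj

theorem act_x_v_pow_n (h1 : mu ≠ 1) : α.act (Taft.x hn hlam) (v ^ n) = 0 := by
  obtain ⟨j, hj⟩ : ∃ j, n = j + 2 := ⟨n - 2, by omega⟩
  have hd : n ∣ j + 2 := ⟨1, by omega⟩
  have h := T.act_x_v_pow j
  rw [T.defect_eq_zero h1 hd, geom_sum_eq_zero (hlam.ne_one hn)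
    ((hlam.pow_eq_one_iff_dvd _).2 hd), mul_zero, zero_smul, zero_smul, add_zero] at h
  rw [← h]
  congr 2

theorem v_pow_mem_fixedRing (h1 : mu ≠ 1) : v ^ n ∈ α.fixedRing := by
  refine (Taft.mem_fixedRing_iff α).2 ⟨?_, T.act_x_v_pow_n h1⟩
  rw [Taft.act_g_pow, T.g_v, smul_pow, mul_pow, T.mu_pow, hlam.pow_eq_one, one_mul, one_smul]

theorem act_x_u_pow (i : ℕ) : α.act (Taft.x hn hlam) (u ^ i) = 0 := by
  have := T.act_x_u_pow_mul i 1
  rwa [mul_one, Taft.act_x_one, mul_zero, smul_zero] at this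

theorem u_pow_mem_fixedRing {m : ℕ} (hm : mu ^ m = 1) : u ^ m ∈ α.fixedRing :=
  (Taft.mem_fixedRing_iff α).2 ⟨by rw [T.act_g_u_pow, hm, one_smul], T.act_x_u_pow m⟩

theorem fixedRing_eq (h1 : mu ≠ 1) {m : ℕ} (hm : orderOf mu = m) :
    α.fixedRing = Algebra.adjoin k {u ^ m, v ^ n} := by
  refine le_antisymm (fun a ha => ?_) (Algebra.adjoin_le ?_)
  · obtain ⟨hg, hx⟩ := (Taft.mem_fixedRing_iff α).1 ha
    rw [← T.basis.linearCombination_repr a, Finsupp.linearCombination_apply, Finsupp.sum]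
    refine Subalgebra.sum_mem _ fun p hp => Subalgebra.smul_mem _ ?_ _
    obtain ⟨i, j⟩ := p
    rw [Finsupp.mem_support_iff] at hp
    have hj : n ∣ j := by
      by_contra hj
      exact hp (T.coord_eq_zero_of_act_x h1 hx i j hj)
    have hi : m ∣ i := by
      have h2 := T.coord_act_g a (i, j)
      rw [hg, mul_pow, (hlam.pow_eq_one_iff_dvd _).2 hj] at h2
      obtain ⟨d, rfl⟩ := hj
      rw [pow_mul mu, T.mu_pow, one_pow, one_mul, mul_one] at h2
      rw [← hm]
      exact orderOf_dvd_of_pow_eq_one (mul_right_cancel₀ hp (by rw [one_mul]; exact h2.symm))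
    obtain ⟨d, rfl⟩ := hj
    obtain ⟨e, rfl⟩ := hi
    rw [T.basis_apply, pow_mul, pow_mul]
    exact Subalgebra.mul_mem _ (Subalgebra.pow_mem _ (Algebra.subset_adjoin (by simp)) _)
      (Subalgebra.pow_mem _ (Algebra.subset_adjoin (by simp)) _)
  · rintro _ (rfl | rfl)
    · exact T.u_pow_mem_fixedRing (hm ▸ pow_orderOf_eq_one mu)
    · exact T.v_pow_mem_fixedRing h1

theorem commute_powers (h1 : mu ≠ 1) (m : ℕ) : Commute (u ^ m) (v ^ n) :=
  (T.pair.commute_v_pow h1 T.mu_pow).pow_left m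

theorem isPolynomialRingIn_fixedRing (h1 : mu ≠ 1) {m : ℕ} (hm : orderOf mu = m) (hm0 : 0 < m) :
    IsPolynomialRingIn α.fixedRing (u ^ m) (v ^ n) := by
  refine isPolynomialRingIn_of_indep (T.commute_powers h1 m) ?_ (T.fixedRing_eq h1 hm)
  have := T.pair.indep.comp (fun p : ℕ × ℕ => (m * p.1, n * p.2)) fun p q hpq => by
    have h2 := Prod.ext_iff.1 hpq
    exact Prod.ext (Nat.eq_of_mul_eq_mul_left hm0 h2.1)
      (Nat.eq_of_mul_eq_mul_left (by omega) h2.2)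
  convert this using 2 with p
  simp [pow_mul]

end

end IsTriangularAction

end Triangular

/-! ### Primeness of the smash product -/

section Primeness

variable {k : Type*} [Field k]

/-- The invertibility of the Vandermonde matrix of the `n`-th roots of unity, for sequences in a
vector space. -/
theorem eq_zero_of_forall_sum_pow_smul [CharZero k] {V : Type*} [AddCommGroup V] [Module k V] {n : ℕ} {z : k}
    (hz : IsPrimitiveRoot z n) {a : Fin n → V}
    (h : ∀ l : ℕ, ∑ i : Fin n, z ^ (l * (i : ℕ)) • a i = 0) (i : Fin n) : a i = 0 := by
  have hn0 : n ≠ 0 := by have := i.2; omega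
  have hz0 : z ≠ 0 := hz.ne_zero hn0
  have e : ∀ j : Fin n, ∑ l ∈ Finset.range n, z⁻¹ ^ (l * (i : ℕ)) * z ^ (l * (j : ℕ)) =
      if j = i then (n : k) else 0 := by
    intro j
    have h1 : ∀ l : ℕ, z⁻¹ ^ (l * (i : ℕ)) * z ^ (l * (j : ℕ)) =
        (z⁻¹ ^ (i : ℕ) * z ^ (j : ℕ)) ^ l := by
      intro l
      rw [mul_pow, ← pow_mul, ← pow_mul, mul_comm l, mul_comm l]
    simp only [h1]
    split_ifs with hij
    · subst hij
      simp [hz0]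
    · refine geom_sum_eq_zero (fun h2 => hij ?_) ?_
      · rw [inv_pow, inv_mul_eq_one₀ (pow_ne_zero _ hz0)] at h2
        exact Fin.ext (hz.pow_inj j.2 i.2 h2.symm)
      · rw [mul_pow, ← pow_mul, ← pow_mul, mul_comm, mul_comm (i : ℕ), pow_mul, pow_mul, inv_pow,
          hz.pow_eq_one]
        simp [pow_right_comm z, hz.pow_eq_one]
  have h2 : ∑ l ∈ Finset.range n, z⁻¹ ^ (l * (i : ℕ)) • ∑ j : Fin n, z ^ (l * (j : ℕ)) • a j = 0 :=
    Finset.sum_eq_zero fun l _ => by rw [h l, smul_zero]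
  simp only [Finset.smul_sum, smul_smul] at h2
  rw [Finset.sum_comm] at h2
  simp only [← Finset.sum_smul, e, ite_smul, zero_smul, Finset.sum_ite_eq', Finset.mem_univ,
    if_true] at h2
  exact (smul_eq_zero.1 h2).resolve_left (Nat.cast_ne_zero.2 hn0)

namespace IsTriangularAction

open HopfAction

variable {n : ℕ} {lam : k} {hn : 1 < n} {hlam : IsPrimitiveRoot lam n}
  {A : Type*} [Ring A] [Algebra k A] {α : HopfAction k (Taft hn hlam) A} {mu κ c : k} {u v : A}

section

variable (T : IsTriangularAction α mu κ c u v)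
include T

theorem iterate_x_u_pow_mul (l i : ℕ) (a : A) : (α.act (Taft.x hn hlam) ^ l) (u ^ i * a) =
    (mu ^ i) ^ l • (u ^ i * (α.act (Taft.x hn hlam) ^ l) a) := by
  induction l with
  | zero => simp
  | succ l ih =>
    rw [pow_succ', Module.End.mul_apply, ih, map_smul, T.act_x_u_pow_mul, smul_smul, ← pow_succ,
      pow_succ', Module.End.mul_apply]

theorem iterate_g_u_pow (l i : ℕ) :
    (α.act (Taft.g hn hlam) ^ l) (u ^ i) = mu ^ (i * l) • u ^ i := by
  induction l with
  | zero => simp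
  | succ l ih =>
    rw [pow_succ', Module.End.mul_apply, ih, map_smul, T.act_g_u_pow, smul_smul, ← pow_add,
      mul_add, mul_one]

theorem iterate_x_v_pow_succ (l j : ℕ) : (α.act (Taft.x hn hlam) ^ (l + 1)) (v ^ (j + 2)) =
    ((c * ∑ i ∈ Finset.range (j + 2), lam ^ i) * mu ^ l) •
        (u * (α.act (Taft.x hn hlam) ^ l) (v ^ (j + 1))) +
      defect lam mu κ c (j + 2) • (α.act (Taft.x hn hlam) ^ l) (v ^ j) := by
  have h := T.iterate_x_u_pow_mul l 1 (v ^ (j + 1))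
  rw [pow_one, pow_one] at h
  rw [pow_succ, Module.End.mul_apply, T.act_x_v_pow, map_add, map_smul, map_smul, h, smul_smul]

theorem iterate_x_v_pow_of_lt : ∀ (j l : ℕ), j < l → (α.act (Taft.x hn hlam) ^ l) (v ^ j) = 0
  | _, 0, h => by omega
  | 0, l + 1, _ => by rw [pow_succ, Module.End.mul_apply, pow_zero, Taft.act_x_one, map_zero]
  | 1, 1, h => by omega
  | 1, l + 2, _ => by
    rw [pow_succ, Module.End.mul_apply, pow_one, T.x_v, pow_succ, Module.End.mul_apply, map_smul,
      T.x_u, smul_zero, map_zero]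
  | j + 2, l + 1, h => by
    rw [T.iterate_x_v_pow_succ, iterate_x_v_pow_of_lt (j + 1) l (by omega),
      iterate_x_v_pow_of_lt j l (by omega)]
    simp

theorem exists_iterate_x_v_pow : ∀ j : ℕ, j < n →
    ∃ C : k, C ≠ 0 ∧ (α.act (Taft.x hn hlam) ^ j) (v ^ j) = C • u ^ j
  | 0, _ => ⟨1, one_ne_zero, by simp⟩
  | 1, _ => ⟨c, T.c_ne_zero, by simpa using T.x_v⟩
  | j + 2, h => by
    obtain ⟨C, hC, hC2⟩ := exists_iterate_x_v_pow (j + 1) (by omega)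
    refine ⟨(c * ∑ i ∈ Finset.range (j + 2), lam ^ i) * mu ^ (j + 1) * C, mul_ne_zero (mul_ne_zero
      (mul_ne_zero T.c_ne_zero (geom_sum_ne_zero hlam (Nat.not_dvd_of_pos_of_lt (by omega) h)))
      (pow_ne_zero _ T.mu_ne_zero)) hC, ?_⟩
    rw [T.iterate_x_v_pow_succ, hC2, T.iterate_x_v_pow_of_lt j (j + 1) (by omega), smul_zero,
      add_zero, mul_smul_comm, smul_smul, ← pow_succ']

/-- If `μ` has order `n`, then `A` is a faithful `A # H`-module. For `r = ∑ a_{ij} # g ^ i x ^ j`,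
evaluating `r` at `u ^ l v ^ j` isolates the coefficients `a_{ij}`, once those with smaller `j` are
known to vanish, and the powers `μ ^ (i l)` separate them. -/
theorem smashRep_faithful [CharZero k] (h1 : mu ≠ 1) (hmu : IsPrimitiveRoot mu n) {r : α.SmashProduct}
    (hr : α.smashRep α.act r = 0) : r = 0 := by
  obtain ⟨a, rfl⟩ := Taft.exists_eq_sum_mk α r
  suffices h : ∀ j : ℕ, ∀ hj : j < n, ∀ i : Fin n, a (i, ⟨j, hj⟩) = 0 by
    refine Finset.sum_eq_zero fun p _ => ?_
    obtain ⟨i, j, hj⟩ := p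
    rw [h j hj i, SmashProduct.mk_zero_left]
  intro j
  induction j using Nat.strong_induction_on with
  | _ j ih =>
  intro hj
  obtain ⟨C, hC, hC2⟩ := T.exists_iterate_x_v_pow j hj
  have h2 : ∀ l : ℕ, ∑ i : Fin n, mu ^ ((l + j) * (i : ℕ)) • a (i, ⟨j, hj⟩) = 0 := by
    intro l
    have e := LinearMap.congr_fun hr (u ^ l * v ^ j)
    rw [map_sum, LinearMap.sum_apply, LinearMap.zero_apply, Fintype.sum_prod_type] at e
    have e2 : ∀ i : Fin n, ∑ j' : Fin n, α.smashRep α.act (SmashProduct.mk α (a (i, j'))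
        (Taft.g hn hlam ^ (i : ℕ) * Taft.x hn hlam ^ (j' : ℕ))) (u ^ l * v ^ j) =
        ((mu ^ l) ^ j * C) • ((mu ^ ((l + j) * (i : ℕ)) • a (i, ⟨j, hj⟩)) * u ^ (l + j)) := by
      intro i
      rw [Finset.sum_eq_single ⟨j, hj⟩]
      · rw [smashRep_mk, map_mul α.act, map_pow α.act, map_pow α.act, Module.End.mul_apply, T.iterate_x_u_pow_mul,
          hC2, mul_smul_comm, smul_smul, map_smul, ← pow_add, T.iterate_g_u_pow, mul_smul_comm,
          mul_smul_comm, smul_mul_assoc]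
      · intro j' _ hne
        rcases lt_or_gt_of_ne (fun h => hne (Fin.ext h) : (j' : ℕ) ≠ j) with hlt | hgt
        · rw [smashRep_mk, ih j' hlt j'.2 i, zero_mul]
        · rw [smashRep_mk, map_mul α.act, map_pow α.act, map_pow α.act, Module.End.mul_apply, T.iterate_x_u_pow_mul,
            T.iterate_x_v_pow_of_lt _ _ hgt, mul_zero, smul_zero, map_zero, mul_zero]
      · simp
    rw [Finset.sum_congr rfl fun i _ => e2 i, ← Finset.smul_sum, ← Finset.sum_mul] at e
    exact T.pair.mul_u_pow_cancel T.mu_ne_zero h1 T.mu_pow (by omega) _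
      ((smul_eq_zero.1 e).resolve_left
        (mul_ne_zero (pow_ne_zero _ (pow_ne_zero _ T.mu_ne_zero)) hC))
  refine eq_zero_of_forall_sum_pow_smul hmu fun l => ?_
  have h3 := h2 (l + (n - 1) * j)
  rw [show l + (n - 1) * j + j = l + n * j by
    rw [add_assoc, ← Nat.succ_mul, Nat.succ_eq_add_one, Nat.sub_add_cancel hn.le]] at h3
  simpa [add_mul, pow_add, mul_assoc, pow_mul, hmu.pow_eq_one] using h3

/-- If `μ` has order `n`, then each nonzero `A # H`-submodule of `A` contains a nonzero fixed
element: apply a power of `x` to land in the kernel of `x`, project to an eigenspace of `g`, where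
the eigenvalue is a power of `μ`, and multiply by a power of `u`. -/
theorem exists_smashRep_mem_fixedRing [CharZero k] (hmu : IsPrimitiveRoot mu n) {p : A} (hp : p ≠ 0) :
    ∃ r : α.SmashProduct, α.smashRep α.act r p ∈ α.fixedRing ∧ α.smashRep α.act r p ≠ 0 := by
  classical
  obtain ⟨l, hl, hl1⟩ : ∃ l : ℕ, (α.act (Taft.x hn hlam) ^ l) p ≠ 0 ∧
      (α.act (Taft.x hn hlam) ^ (l + 1)) p = 0 := by
    have hex : ∃ l : ℕ, (α.act (Taft.x hn hlam) ^ (l + 1)) p = 0 :=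
      ⟨n - 1, by rw [Nat.sub_add_cancel hn.le]; exact Taft.act_x_iterate α p⟩
    refine ⟨Nat.find hex, ?_, Nat.find_spec hex⟩
    rcases h : Nat.find hex with _ | l
    · simpa using hp
    · exact Nat.find_min hex (by omega)
  set p₁ := (α.act (Taft.x hn hlam) ^ l) p with hp₁
  have hxp : α.act (Taft.x hn hlam) p₁ = 0 := by
    rw [hp₁, ← Module.End.mul_apply, ← pow_succ', hl1]
  have hinv : IsPrimitiveRoot mu⁻¹ n := hmu.inv
  let q : ℕ → A := fun s =>
    ∑ i ∈ Finset.range n, mu⁻¹ ^ (s * i) • (α.act (Taft.g hn hlam) ^ i) p₁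
  obtain ⟨s, hs⟩ : ∃ s, q s ≠ 0 := by
    by_contra! hq
    refine hl ?_
    have := eq_zero_of_forall_sum_pow_smul hinv
      (a := fun i : Fin n => (α.act (Taft.g hn hlam) ^ (i : ℕ)) p₁)
      (fun s => by rw [← hq s]; exact (Finset.sum_range
        (fun i => mu⁻¹ ^ (s * i) • (α.act (Taft.g hn hlam) ^ i) p₁)).symm) ⟨0, by omega⟩
    simpa using this
  have hgq : α.act (Taft.g hn hlam) (q s) = mu ^ s • q s := by
    let f : ℕ → A := fun i => mu⁻¹ ^ (s * i) • (α.act (Taft.g hn hlam) ^ i) p₁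
    have hf : ∑ i ∈ Finset.range n, f (i + 1) = ∑ i ∈ Finset.range n, f i := by
      have h1 := Finset.sum_range_succ f n
      rw [Finset.sum_range_succ'] at h1
      have h2 : f n = f 0 := by
        simp only [f, mul_zero, pow_zero, one_smul, Module.End.one_apply, Taft.act_g_iterate]
        rw [mul_comm, pow_mul, hinv.pow_eq_one, one_pow, one_smul]
      rw [h2] at h1
      exact add_right_cancel h1
    change _ = mu ^ s • ∑ i ∈ Finset.range n, f i
    rw [← hf, map_sum, Finset.smul_sum]
    refine Finset.sum_congr rfl fun i _ => ?_
    have hc : mu ^ s * mu⁻¹ ^ (s * (i + 1)) = mu⁻¹ ^ (s * i) := by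
      rw [mul_add, mul_one, pow_add, mul_left_comm, inv_pow _ s,
        mul_inv_cancel₀ (pow_ne_zero _ T.mu_ne_zero), mul_one]
    rw [map_smul, smul_smul, hc, ← Module.End.mul_apply, ← pow_succ']
  have hxq : α.act (Taft.x hn hlam) (q s) = 0 := by
    rw [map_sum]
    refine Finset.sum_eq_zero fun i _ => ?_
    rw [map_smul, ← map_pow, ← Module.End.mul_apply, ← map_mul, Taft.x_mul_g_pow, map_smul,
      map_mul, LinearMap.smul_apply, Module.End.mul_apply, hxp, map_zero, smul_zero, smul_zero]
  refine ⟨SmashProduct.mk α (u ^ (s * (n - 1)))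
    ((∑ i ∈ Finset.range n, mu⁻¹ ^ (s * i) • Taft.g hn hlam ^ i) * Taft.x hn hlam ^ l), ?_⟩
  have hval : α.smashRep α.act (SmashProduct.mk α (u ^ (s * (n - 1)))
      ((∑ i ∈ Finset.range n, mu⁻¹ ^ (s * i) • Taft.g hn hlam ^ i) * Taft.x hn hlam ^ l)) p =
      u ^ (s * (n - 1)) * q s := by
    rw [smashRep_mk, map_mul, Module.End.mul_apply, map_pow, map_sum, LinearMap.sum_apply]
    congr 1
    refine Finset.sum_congr rfl fun i _ => ?_
    rw [map_smul, map_pow, LinearMap.smul_apply]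
  rw [hval]
  refine ⟨(Taft.mem_fixedRing_iff α).2 ⟨?_, ?_⟩, fun h =>
    hs (T.pair.u_pow_mul_cancel T.mu_ne_zero _ h)⟩
  · rw [Taft.act_g_mul, T.act_g_u_pow, hgq, smul_mul_smul_comm, ← pow_add]
    rw [show s * (n - 1) + s = n * s by
      rw [← Nat.mul_succ, Nat.succ_eq_add_one, Nat.sub_add_cancel hn.le, mul_comm], pow_mul,
      T.mu_pow, one_pow, one_smul]
  · rw [T.act_x_u_pow_mul, hxq, mul_zero, smul_zero]

theorem commute_of_mem_fixedRing (h1 : mu ≠ 1) (hmu : IsPrimitiveRoot mu n) {z : A}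
    (hz : z ∈ α.fixedRing) (q : A) : Commute q z := by
  rw [T.fixedRing_eq h1 hmu.eq_orderOf.symm] at hz
  have hle : Algebra.adjoin k {u ^ n, v ^ n} ≤ Subalgebra.center k A := by
    refine Algebra.adjoin_le ?_
    rintro _ (rfl | rfl)
    · exact Subalgebra.mem_center_iff.2 fun a =>
        T.pair.commute_u_pow T.mu_ne_zero h1 T.mu_pow a
    · exact Subalgebra.mem_center_iff.2 fun a => T.pair.commute_of_commute_gens
        (T.pair.commute_v_pow h1 T.mu_pow) (Commute.self_pow v n) a
  exact Subalgebra.mem_center_iff.1 (hle hz) q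

theorem isPrimeRing [CharZero k] (h1 : mu ≠ 1) (hmu : IsPrimitiveRoot mu n) : IsPrimeRing α.SmashProduct := by
  have := T.pair.nontrivial
  refine α.isPrimeRing_of_faithful (fun r => T.smashRep_faithful h1 hmu) fun p hp => ?_
  obtain ⟨r, hr, hr0⟩ := T.exists_smashRep_mem_fixedRing hmu hp
  refine ⟨r, hr, fun q hq => ?_⟩
  rw [(T.commute_of_mem_fixedRing h1 hmu hr q).eq] at hq
  rw [T.fixedRing_eq h1 hmu.eq_orderOf.symm, ← range_commEval (T.commute_powers h1 n)] at hr
  obtain ⟨f, hf⟩ := hr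
  rw [← hf] at hr0 hq
  exact normalEval_mul_cancel (T.pair.commute_v_pow h1 T.mu_pow) T.pair.indep
    (T.pair.span_eq_top T.mu_ne_zero) hr0 hq

theorem mk_integral_ne_zero [CharZero k] : SmashProduct.mk α 1 (Taft.integral : Taft hn hlam) ≠ 0 := by
  intro h
  obtain ⟨C, hC, hC2⟩ := T.exists_iterate_x_v_pow (n - 1) (by omega)
  have e := LinearMap.congr_fun (congrArg (α.smashRep α.act) h) (u ^ 1 * v ^ (n - 1))
  have e2 : ∀ i ∈ Finset.range n, (α.act (Taft.g hn hlam ^ i)) (u ^ n) = u ^ n := by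
    intro i _
    rw [map_pow α.act, T.iterate_g_u_pow, pow_mul, T.mu_pow, one_pow, one_smul]
  rw [smashRep_mk, Taft.integral, map_mul α.act, Module.End.mul_apply, map_pow α.act, T.iterate_x_u_pow_mul,
    hC2, mul_smul_comm, ← pow_add, show 1 + (n - 1) = n by omega, smul_smul, map_smul, map_sum α.act,
    LinearMap.sum_apply, Finset.sum_congr rfl e2, Finset.sum_const, Finset.card_range, map_zero,
    LinearMap.zero_apply, one_mul, ← Nat.cast_smul_eq_nsmul k, smul_smul] at e
  have hu : u ^ n ≠ 0 := by simpa using T.pair.indep.ne_zero (n, 0)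
  refine (smul_ne_zero (mul_ne_zero (mul_ne_zero ?_ hC) ?_) hu) e
  · exact pow_ne_zero _ (pow_ne_zero _ T.mu_ne_zero)
  · exact Nat.cast_ne_zero.2 (by omega)

end

section

variable (T : IsTriangularAction α mu 0 c u v)
include T

theorem v_mul_act_x_monomial (i j : ℕ) :
    v * α.act (Taft.x hn hlam) (u ^ i * v ^ j) =
      (mu⁻¹ * (c * ∑ l ∈ Finset.range j, lam ^ l)) • (u ^ (i + 1) * v ^ j) := by
  have h0 := T.mu_ne_zero
  have hvu : v * u = mu⁻¹ • (u * v) := by simpa using T.pair.v_mul_u h0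
  have hx : v * α.act (Taft.x hn hlam) (v ^ j) =
      (mu⁻¹ * (c * ∑ l ∈ Finset.range j, lam ^ l)) • (u * v ^ j) := by
    rcases j with _ | _ | j
    · simp [Taft.act_x_one]
    · simp [T.x_v, hvu, smul_smul, mul_comm]
    · rw [T.act_x_v_pow, defect_of_kappa_eq_zero, zero_smul, add_zero, mul_smul_comm, ← mul_assoc,
        hvu, smul_mul_assoc, mul_assoc, ← pow_succ', smul_smul, mul_comm mu⁻¹]
  rw [T.act_x_u_pow_mul, mul_smul_comm, ← mul_assoc, mul_pow_of_qcomm hvu, smul_mul_assoc,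
    smul_smul, inv_pow, mul_inv_cancel₀ (pow_ne_zero _ h0), one_smul, mul_assoc, hx, mul_smul_comm,
    pow_succ, mul_assoc (u ^ i)]

/-- If `κ = 0` and `μ` has order less than `n`, then `A # H` does not act faithfully on `A`. The
element `w = μ (1 - λ) c⁻¹ v x - u` maps `u ^ i v ^ j` to `-λ ^ j u ^ (i + 1) v ^ j`, so that
`w ^ m - (-1) ^ m u ^ m g ^ m` acts as zero. This element is nonzero because it acts nontrivially
on `A` after twisting with the automorphism `g ↦ λ g` of `H`. -/
theorem exists_annihilator {m : ℕ} (hm : mu ^ m = 1) (hm0 : 0 < m) (hmn : m < n) :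
    ∃ r : α.SmashProduct, r ≠ 0 ∧ α.smashRep α.act r = 0 := by
  let w : α.SmashProduct := SmashProduct.mk α ((mu * (1 - lam) * c⁻¹) • v) (Taft.x hn hlam) -
    SmashProduct.mk α u 1
  have h0 := T.mu_ne_zero
  have hc := T.c_ne_zero
  have hw : ∀ β : Taft hn hlam →ₐ[k] Module.End k A,
      β (Taft.x hn hlam) = α.act (Taft.x hn hlam) → ∀ i j : ℕ,
      α.smashRep β w (u ^ i * v ^ j) = (-lam ^ j) • (u ^ (i + 1) * v ^ j) := by
    intro β hβ i j
    have hg : (1 - lam) * ∑ l ∈ Finset.range j, lam ^ l = 1 - lam ^ j := mul_neg_geom_sum lam j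
    rw [map_sub, LinearMap.sub_apply, smashRep_mk, smashRep_mk, hβ, map_one, Module.End.one_apply,
      smul_mul_assoc, T.v_mul_act_x_monomial, smul_smul, ← mul_assoc u, ← pow_succ']
    have : mu * (1 - lam) * c⁻¹ * (mu⁻¹ * (c * ∑ l ∈ Finset.range j, lam ^ l)) = 1 - lam ^ j := by
      rw [← hg]; field_simp
    rw [this]
    module
  have hwl : ∀ β : Taft hn hlam →ₐ[k] Module.End k A,
      β (Taft.x hn hlam) = α.act (Taft.x hn hlam) → ∀ l i j : ℕ,
      (α.smashRep β w ^ l) (u ^ i * v ^ j) = (-lam ^ j) ^ l • (u ^ (i + l) * v ^ j) := by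
    intro β hβ l i j
    induction l with
    | zero => simp
    | succ l ih =>
      rw [pow_succ', Module.End.mul_apply, ih, map_smul, hw β hβ, smul_smul, ← pow_succ, add_assoc]
  let r : α.SmashProduct := w ^ m - SmashProduct.mk α ((-1 : k) ^ m • u ^ m) (Taft.g hn hlam ^ m)
  refine ⟨r, fun hr => ?_, T.basis.ext fun p => ?_⟩
  · have e := LinearMap.congr_fun (congrArg (α.smashRep (α.act.comp Taft.twist)) hr) (u ^ 0 * v ^ 0)
    rw [map_sub, LinearMap.sub_apply, smashRep_pow α (Taft.isCompatible_twist α),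
      hwl _ (by simp), smashRep_mk, AlgHom.comp_apply, map_pow, Taft.twist_g, smul_pow, map_smul,
      map_pow, map_zero, LinearMap.zero_apply, LinearMap.smul_apply, pow_zero v, mul_one (u ^ 0),
      T.iterate_g_u_pow] at e
    simp only [pow_zero, mul_one, zero_mul, one_smul, zero_add, mul_smul_comm] at e
    rw [smul_smul, ← sub_smul] at e
    have hu : u ^ m ≠ 0 := by simpa using T.pair.indep.ne_zero (m, 0)
    have e2 := (smul_eq_zero.1 e).resolve_right hu
    have e3 : (-1 : k) ^ m * (1 - lam ^ m) = 0 := by linear_combination e2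
    refine (mul_ne_zero (pow_ne_zero _ (neg_ne_zero.2 one_ne_zero)) (sub_ne_zero.2 fun h => ?_)) e3
    exact hlam.pow_ne_one_of_pos_of_lt hm0.ne' hmn h.symm
  · obtain ⟨i, j⟩ := p
    have hgl : ∀ l : ℕ, (α.act (Taft.g hn hlam) ^ l) (u ^ i * v ^ j) =
        (mu ^ i * (lam * mu) ^ j) ^ l • (u ^ i * v ^ j) := by
      intro l
      induction l with
      | zero => simp
      | succ l ih =>
        rw [pow_succ', Module.End.mul_apply, ih, map_smul, T.act_g_monomial, smul_smul, pow_succ]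
    rw [T.basis_apply, map_sub, LinearMap.sub_apply, smashRep_pow α α.isCompatible_act,
      hwl _ rfl, smashRep_mk, map_pow, hgl, LinearMap.zero_apply, mul_smul_comm, smul_mul_assoc,
      smul_smul, ← mul_assoc, ← pow_add, add_comm m, ← sub_smul]
    have e : (mu ^ i * (lam * mu) ^ j) ^ m = (lam ^ j) ^ m := by
      calc _ = (mu ^ m) ^ i * (mu ^ m) ^ j * (lam ^ j) ^ m := by ring
        _ = _ := by rw [hm]; simp
    rw [e, neg_pow, mul_comm, sub_self, zero_smul]

end

theorem isPrimeRing_iff [CharZero k] (T : IsTriangularAction α mu κ c u v) {m : ℕ} (hm1 : 1 < m)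
    (hm : orderOf mu = m) : IsPrimeRing α.SmashProduct ↔ m = n := by
  have h1 : mu ≠ 1 := by
    rintro rfl
    rw [orderOf_one] at hm
    omega
  have hmm : mu ^ m = 1 := hm ▸ pow_orderOf_eq_one mu
  refine ⟨fun hprime => ?_, ?_⟩
  · by_contra hne
    have hdvd : m ∣ n := hm ▸ orderOf_dvd_of_pow_eq_one T.mu_pow
    have hlt : m < n := lt_of_le_of_ne (Nat.le_of_dvd (by omega) hdvd) hne
    have hκ : κ = 0 := by
      by_contra hκ
      have e : lam * mu ^ 2 = 1 := mul_right_cancel₀ hκ (by rw [T.weyl, one_mul])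
      have e2 : lam ^ m = 1 := by
        have := congrArg (· ^ m) e
        simpa [mul_pow, pow_right_comm mu 2 m, hmm] using this
      exact hlam.pow_ne_one_of_pos_of_lt (by omega) hlt e2
    subst hκ
    obtain ⟨r, hr, hr0⟩ := T.exists_annihilator hmm (by omega) hlt
    exact α.not_isPrimeRing_of_integral Taft.mul_integral T.mk_integral_ne_zero hr hr0 hprime
  · rintro rfl
    exact T.isPrimeRing h1 (hm ▸ IsPrimitiveRoot.orderOf mu)

end IsTriangularAction

end Primeness

end

end TaftSmash

open TaftSmash in
theorem lemma2p3 {k : Type*} [Field k] [IsAlgClosed k] [CharZero k]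
    {n m : ℕ} {lam mu : k} (hn : 1 < n) (hlam : IsPrimitiveRoot lam n)
    (hm : 1 < m) (hmu : orderOf mu = m)
    (κ : k) (hκ : κ = 0 ∨ κ = 1)
    (α : HopfAction k (Taft hn hlam) (QuantumAlgebra mu κ))
    (hlin : IsLinearAction α) (hif : α.InnerFaithful) :
    ((α.act (Taft.x hn hlam) (QuantumAlgebra.u mu κ) = 0 ∧
        IsPolynomialRingIn α.fixedRing
          (QuantumAlgebra.u mu κ ^ m) (QuantumAlgebra.v mu κ ^ n)) ∨
      (α.act (Taft.x hn hlam) (QuantumAlgebra.v mu κ) = 0 ∧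
        IsPolynomialRingIn α.fixedRing
          (QuantumAlgebra.u mu κ ^ n) (QuantumAlgebra.v mu κ ^ m))) ∧
    (IsPrimeRing α.SmashProduct ↔ m = n) := by
  have h1 : mu ≠ 1 := by
    rintro rfl
    rw [orderOf_one] at hmu
    omega
  have h0 : mu ≠ 0 := by
    rintro rfl
    have := pow_orderOf_eq_one (0 : k)
    rw [hmu, zero_pow (by omega)] at this
    exact zero_ne_one this
  rcases exists_isTriangularAction α (QuantumAlgebra.isQuantumPair h0) h0 h1 hlin
    (Taft.exists_act_x_ne_zero α hif (QuantumAlgebra.adjoin_u_v mu κ)) with ⟨c, T⟩ | ⟨c, T⟩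
  · exact ⟨Or.inl ⟨T.x_u, T.isPolynomialRingIn_fixedRing h1 hmu (by omega)⟩,
      T.isPrimeRing_iff hm hmu⟩
  · have hmu' : orderOf mu⁻¹ = m := by
      rw [← hmu]
      exact orderOf_eq_orderOf_iff.2 fun j => by simp
    exact ⟨Or.inr ⟨T.x_u, (T.isPolynomialRingIn_fixedRing (by simpa using h1) hmu'
      (by omega)).swap⟩, T.isPrimeRing_iff hm hmu'⟩
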